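/- Conventions. Let $q=p^\ell$ be a power of a prime $p$. A stabilizer matrix is a polynomial matrix $S(D)=(X(D)\,|\,Z(D))\in\mathbb F_q[D]^{r\times 2n}$; it defines a quantum convolutional code of frame size $n$ if it has full rank $r$ and $X(D)Z(1/D)^t-Z(D)X(1/D)^t=0$ (a block code if all entries are constants). Its constraint length is $\nu=\sum_i\max_j\max(\deg X_{ij},\deg Z_{ij})$. Two stabilizer matrices define the same stabilizer if their rows span the same $\mathbb F_q[D,D^{-1}]$-module. A polynomial matrix $G(D)$ is non-catastrophic if every power series vector $u(D)$ for which $u(D)G(D)$ has finite weight has finite weight, and delay-free if $G(0)$ has full row rank. A circuit is a finite sequence of layers. Each layer consists of generalized Clifford gates acting on disjoint qudits of the frame, and every gate is applied together with all its translates by frames. The gates act on rows $(x(D)|z(D))$, on the columns concerned, by right multiplication with the following matrices: the Fourier transform $\begin{pmatrix}0&-1\\1&0\end{pmatrix}$; the multiplication gate $\begin{pmatrix}\gamma^{-1}&0\\0&\gamma\end{pmatrix}$ with $\gamma\in\mathbb F_q^*$; the diagonal gate $\begin{pmatrix}1&\gamma\\0&1\end{pmatrix}$ with $\gamma\in\mathbb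 F_q$; the gate $\mathrm{ADD}$ from qudit $i$ to qudit $j\neq i$ that is $l\in\mathbb Z$ frames later, acting by $\begin{pmatrix}1&D^l\\0&1\end{pmatrix}$ on the $X$-part and $\begin{pmatrix}1&0\\-D^{-l}&1\end{pmatrix}$ on the $Z$-part; and the controlled phase gate between copies of a qudit $l\neq0$ frames apart, acting by $\begin{pmatrix}1&D^l+D^{-l}\\0&1\end{pmatrix}$. The depth of a circuit is its number of time steps (a layer takes one step, or two if it contains a controlled phase gate); it does not depend on the length of the stream. An encoding circuit for $S(D)$ is a circuit that transforms the stabilizer $(0\,|\,I\;0)$ of $r$ ancilla qudits per frame, in suitable positions, into the stabilizer of $S(D)$. Theorem. There is a polynomial $P(n,\nu)$, independent of all other data, with the following property. Let $G_1(D)\in\mathbb F_p[D]^{k_1\times n_1}$, $k_1\ge1$, be a non-catastrophic, delay-free generator matrix of a classical convolutional code, and let $S_2=(X|Z)\in\mathbb F_q[D]^{r\times 2n_2}$ be the stabilizer matrix of a quantum block code or of a quantum convolutional code with $S_2$ non-catastrophic. Let $n=n_1n_2$ be the frame size and $\nu$ the constraint length of the quantum convolutional code with stabilizer matrix $G_1(D)\otimes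 S_2=(G_1(D)\otimes X\,|\,G_1(D)\otimes Z)$. Then this code has an encoding circuit of finite depth, independent of the length of the input stream, and the depth is at most $P(n,\nu)$. More precisely, there are an encoding circuit for the CSS-type stabilizer $(G_1(D)\,|\,0)$ on $n_1$ qudits per frame, and a circuit on $n_2$ qudits per frame that transforms the $X$-only stabilizer $(I\;0\,|\,0)$ into that of $S_2$ (so that preceded by Fourier transforms on the $r$ ancillae it is an encoding circuit for $S_2$), such that the following is an encoding circuit for $G_1(D)\otimes S_2$ of depth at most $P(n,\nu)$: index the qudits of a frame by pairs $(i,j)$, $i\le n_1$, $j\le n_2$; first apply $r$ interleaved copies of the former circuit, one for each of the $r$ ancilla positions $j$ of the latter, acting on the qudits $(\cdot,j)$; then apply the latter circuit to each of the $n_1$ blocks $(i,\cdot)$. -/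

import Mathlib

open Polynomial LaurentPolynomial

namespace QConv

/-! ### Convolutional encoders -/

/-- A polynomial matrix `G(D)` is non-catastrophic: an input stream whose output stream `u(D) G(D)`
has finite weight has itself finite weight. (A power series of finite weight is a polynomial.) -/
def NonCatastrophic {F ρ κ : Type*} [Field F] [Fintype ρ] (G : Matrix ρ κ F[X]) : Prop :=
  ∀ u : ρ → PowerSeries F,
    (∀ j, ∃ f : F[X], ∑ i, u i * (G i j : PowerSeries F) = (f : PowerSeries F)) →
      ∀ i, ∃ f : F[X], u i = (f : PowerSeries F)

/-- A polynomial matrix `G(D)` is delay-free: `G(0)` has full row rank. -/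
def DelayFree {F ρ κ : Type*} [Field F] (G : Matrix ρ κ F[X]) : Prop :=
  LinearIndependent F (fun (i : ρ) (j : κ) => (G i j).coeff 0)

/-! ### Stabilizer matrices -/

/-- A polynomial matrix `S(D) = (X(D) | Z(D))`; its rows are indexed by `ρ` and the qudits of one
frame by `ι`. -/
structure Stabilizer (F ρ ι : Type*) [Field F] where
  X : Matrix ρ ι F[X]
  Z : Matrix ρ ι F[X]

/-- Row vectors `(x(D) | z(D))` over the ring of Laurent polynomials in `D`: the coefficient of
`D ^ t` in `x i` and `z i` gives the Pauli matrix on qudit `i` of frame `t`. -/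
abbrev PauliRow (F ι : Type*) [Field F] : Type _ := (ι → F[T;T⁻¹]) × (ι → F[T;T⁻¹])

namespace Stabilizer

variable {F ρ ι : Type*} [Field F]

/-- The matrix `(X(D) | Z(D))` with its `2n` columns. -/
def toMatrix (S : Stabilizer F ρ ι) : Matrix ρ (ι ⊕ ι) F[X] := Matrix.fromCols S.X S.Z

/-- The condition `X(D) Z(1/D)ᵗ - Z(D) X(1/D)ᵗ = 0`. -/
def SelfOrthogonal [Fintype ι] (S : Stabilizer F ρ ι) : Prop :=
  ∀ i j : ρ, ∑ k, (toLaurent (S.X i k) * invert (toLaurent (S.Z j k))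
    - toLaurent (S.Z i k) * invert (toLaurent (S.X j k))) = 0

/-- `S(D)` defines a quantum convolutional code: full rank and self-orthogonal. -/
def IsQCC [Fintype ι] (S : Stabilizer F ρ ι) : Prop :=
  LinearIndependent F[X] S.toMatrix.row ∧ S.SelfOrthogonal

/-- `S` is the stabilizer matrix of a block code: all its entries are constants. -/
def IsBlock (S : Stabilizer F ρ ι) : Prop :=
  ∀ i j, (S.X i j).natDegree = 0 ∧ (S.Z i j).natDegree = 0

/-- The overall constraint length: the sum over the rows of the maximal degree in the row. -/
def constraintLength [Fintype ρ] [Fintype ι] (S : Stabilizer F ρ ι) : ℕ :=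
  ∑ i, Finset.univ.sup fun j => max (S.X i j).natDegree (S.Z i j).natDegree

/-- A row of `S(D)`. -/
noncomputable def row (S : Stabilizer F ρ ι) (i : ρ) : PauliRow F ι :=
  (fun j => toLaurent (S.X i j), fun j => toLaurent (S.Z i j))

/-- The stabilizer generated by the rows of `S(D)` and all their shifts by frames. -/
noncomputable def rowSpace (S : Stabilizer F ρ ι) : Submodule F[T;T⁻¹] (PauliRow F ι) :=
  Submodule.span _ (Set.range S.row)

/-- The trivial `Z`-only stabilizer `(0 | I 0)` of ancillae in the state `|0⟩`; the ancilla that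
belongs to row `i` is qudit `a i` of the frame. -/
noncomputable def trivialZ [DecidableEq ι] (a : ρ ↪ ι) : Stabilizer F ρ ι where
  X := 0
  Z := Matrix.of fun i j => if j = a i then 1 else 0

/-- The trivial `X`-only stabilizer `(I 0 | 0)`, with the same convention. -/
noncomputable def trivialX [DecidableEq ι] (a : ρ ↪ ι) : Stabilizer F ρ ι where
  X := Matrix.of fun i j => if j = a i then 1 else 0
  Z := 0

/-- The `X`-only stabilizer `(G(D) | 0)` of CSS type, for `G(D)` over a subfield `K` of `F`. -/
noncomputable def ofX {K : Type*} [Field K] [Algebra K F] (G : Matrix ρ ι K[X]) :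
    Stabilizer F ρ ι where
  X := G.map (Polynomial.map (algebraMap K F))
  Z := 0

/-- The product `G(D) ⊗ S = (G(D) ⊗ X | G(D) ⊗ Z)`, a Kronecker product of matrices, for `G(D)`
over a subfield `K` of `F`. -/
noncomputable def product {K ρ' ι' : Type*} [Field K] [Algebra K F] (G : Matrix ρ' ι' K[X])
    (S : Stabilizer F ρ ι) : Stabilizer F (ρ' × ρ) (ι' × ι) where
  X := Matrix.kroneckerMap (fun g s => g.map (algebraMap K F) * s) G S.X
  Z := Matrix.kroneckerMap (fun g s => g.map (algebraMap K F) * s) G S.Z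

end Stabilizer

/-! ### Circuits of generalized Clifford gates -/

/-- The generalized Clifford gates. Each of them stands for the gate together with all its
translates by frames:
* `dft i`, `mul γ i`, `phase γ i` act on qudit `i` of every frame;
* `add i j _ l` acts on qudit `i` of frame `t` (source) and qudit `j` of frame `t + l` (target),
  for all `t`;
* `cphase i l _` acts on qudit `i` of frame `t` and qudit `i` of frame `t + l`, for all `t`. -/
inductive Gate (F ι : Type*) [Field F] where
  | dft (i : ι)
  | mul (γ : Fˣ) (i : ι)
  | phase (γ : F) (i : ι)
  | add (i j : ι) (hij : i ≠ j) (l : ℤ)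
  | cphase (i : ι) (l : ℤ) (hl : l ≠ 0)

namespace Gate

variable {F ι κ : Type*} [Field F]

/-- The qudits of the frame on which the gate acts. -/
def wires : Gate F ι → Set ι
  | dft i => {i}
  | mul _ i => {i}
  | phase _ i => {i}
  | add i j _ _ => {i, j}
  | cphase i _ _ => {i}

/-- The number of time steps that the gate and all its translates need. The translates act on
pairwise disjoint sets of qudits, so that one step suffices, except for `cphase i l _`: there each
qudit belongs to the two pairs `{t - l, t}` and `{t, t + l}` of frames. These pairs form paths, so
that two steps are necessary and sufficient. -/
def duration : Gate F ι → ℕ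
  | cphase _ _ _ => 2
  | _ => 1

/-- The action of conjugation by the gate on row vectors `(x(D) | z(D))`. On the columns concerned
it is multiplication from the right by
* `dft`: `(0, -1; 1, 0)`;
* `mul γ`: `(γ⁻¹, 0; 0, γ)`;
* `phase γ`: `(1, γ; 0, 1)`;
* `add`: `(1, D ^ l; 0, 1)` on the `X`-part and `(1, 0; -D ^ (-l), 1)` on the `Z`-part;
* `cphase`: `(1, D ^ l + D ^ (-l); 0, 1)`. -/
noncomputable def act [DecidableEq ι] : Gate F ι → PauliRow F ι → PauliRow F ι
  | dft i, (x, z) => (Function.update x i (z i), Function.update z i (-x i))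
  | mul γ i, (x, z) =>
      (Function.update x i (LaurentPolynomial.C (↑γ⁻¹ : F) * x i),
        Function.update z i (LaurentPolynomial.C (γ : F) * z i))
  | phase γ i, (x, z) => (x, Function.update z i (z i + LaurentPolynomial.C γ * x i))
  | add i j _ l, (x, z) =>
      (Function.update x j (x j + T l * x i), Function.update z i (z i - T (-l) * z j))
  | cphase i l _, (x, z) => (x, Function.update z i (z i + (T l + T (-l)) * x i))

/-- The same gate on other qudits. -/
def map (f : ι ↪ κ) : Gate F ι → Gate F κ
  | dft i => dft (f i)
  | mul γ i => mul γ (f i)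
  | phase γ i => phase γ (f i)
  | add i j h l => add (f i) (f j) (f.injective.ne h) l
  | cphase i l h => cphase (f i) l h

theorem wires_map (f : ι ↪ κ) (g : Gate F ι) : (g.map f).wires = f '' g.wires := by
  cases g <;> simp [map, wires, Set.image_pair]

end Gate

/-- Gates that are applied in parallel: they act on pairwise disjoint sets of qudits. -/
structure Layer (F ι : Type*) [Field F] where
  gates : List (Gate F ι)
  disjoint : gates.Pairwise fun g h => Disjoint g.wires h.wires

namespace Layer

variable {F ι κ : Type*} [Field F]

/-- The number of time steps of a layer: the longest duration of its gates. -/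
def duration (L : Layer F ι) : ℕ := (L.gates.map Gate.duration).foldr max 0

/-- The action of a layer (the order of the gates does not matter, as they commute). -/
noncomputable def act [DecidableEq ι] (L : Layer F ι) (v : PauliRow F ι) : PauliRow F ι :=
  L.gates.foldl (fun w g => g.act w) v

/-- The same layer on other qudits. -/
def map (f : ι ↪ κ) (L : Layer F ι) : Layer F κ where
  gates := L.gates.map (Gate.map f)
  disjoint := by
    refine List.Pairwise.map _ (fun g h hgh => ?_) L.disjoint
    rw [Gate.wires_map, Gate.wires_map]
    exact (Set.disjoint_image_iff f.injective).2 hgh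

end Layer

/-- A circuit: finitely many layers, applied one after the other to the whole stream. It is the
same for streams of any length. -/
abbrev Circuit (F ι : Type*) [Field F] : Type _ := List (Layer F ι)

namespace Circuit

variable {F ρ ι κ : Type*} [Field F]

/-- The depth of a circuit: its number of time steps. -/
def depth (c : Circuit F ι) : ℕ := (List.map Layer.duration c).sum

/-- The action of a circuit; the head of the list is the layer that is applied first. -/
noncomputable def act [DecidableEq ι] (c : Circuit F ι) (v : PauliRow F ι) : PauliRow F ι :=
  List.foldl (fun w L => L.act w) v c

/-- The circuit changes the stabilizer generated by `S(D)` into the one generated by `S'(D)`. -/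
def Transforms [DecidableEq ι] (c : Circuit F ι) (S S' : Stabilizer F ρ ι) : Prop :=
  Submodule.span F[T;T⁻¹] (Set.range fun i => c.act (S.row i)) = S'.rowSpace

/-- The same circuit on other qudits. -/
def map (f : ι ↪ κ) (c : Circuit F ι) : Circuit F κ := List.map (Layer.map f) c

/-- Interleaved copies of a circuit: qudits are indexed by pairs, and the `j`-th copy acts on the
qudits `(i, a j)`. -/
def strandCopies {r : ℕ} (c : Circuit F ι) (a : Fin r ↪ κ) : Circuit F (ι × κ) :=
  (List.finRange r).flatMap fun j =>
    c.map ⟨fun i => (i, a j), fun _ _ h => (Prod.ext_iff.1 h).1⟩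

/-- Blockwise copies of a circuit: qudits are indexed by pairs, and the copy for the block `b` acts
on the qudits `(b, i)`. -/
def blockCopies (n : ℕ) (c : Circuit F ι) : Circuit F (Fin n × ι) :=
  (List.finRange n).flatMap fun b =>
    c.map ⟨fun i => (b, i), fun _ _ h => (Prod.ext_iff.1 h).2⟩

end Circuit

end QConv

open QConv

/-! Both factors are covered by one statement, `Stabilizer.encodable`: a self-orthogonal,
non-catastrophic stabilizer matrix of constraint length N on n qudits is reached from an X-only
trivial stabilizer in depth at most 71 n² (N + 1). Circuits act by isometries of a skew-Hermitian
form on Laurent rows, so the task is to straighten the row module M. It is isotropic, and saturated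
by `Stabilizer.saturated`.

Geometrically, M is a subbundle of a trivial bundle on the projective line, with fibres `lowSpace`
at D = 0 and `highSpace` at D = ∞. Let M₊ be the rows of M without negative powers of D and M₋ those
with only negative powers. The dimension of M / (M₊ + M₋) is the degree of the bundle up to sign,
and is at most N (`Stabilizer.degreeLE`). It drops under an isometry that keeps positive rows of M
positive and negative ones negative and makes one further row positive or negative (`DegreeLE.map`).
Such an isometry of cost O(n) exists unless M is generated by constant rows
(`lowersDegree_or_le_span_cst`). If the two fibres differ, delaying a hyperbolic pair does it. If
they agree but some positive row leaves the common fibre L, a transvection or a Siegel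
transformation does it. Otherwise all coefficients lie in L, and saturation yields constant
generators (`le_span_cst`).

After at most N such steps, symplectic Gaussian elimination within a frame finishes
(`encodable_of_le_span_cst`). Delays are not gates, but they cost nothing, since they can be pushed
through a circuit onto the ancillae (`realizable_delay`).

For the product, the first circuit turns an ancilla (i, j) into g ⊗ X_j, where g has no Z-part. Each
block then holds a scalar multiple of X_j, and the linearity of the second circuit gives g ⊗ s
(`Circuit.act_product`). -/

namespace QConv

/-! ### The skew-Hermitian form on Laurent rows and the symplectic form on one frame. -/

section Form

variable {F ι : Type*} [Field F]

/-- Pauli matrices on a single frame, written as vectors `(x | z)` over `F`. -/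
abbrev Pauli (F ι : Type*) [Field F] : Type _ := (ι → F) × (ι → F)

/-- The coefficient of `D ^ k` of a row `(x(D) | z(D))`. -/
noncomputable def coef (k : ℤ) : PauliRow F ι →ₗ[F] Pauli F ι where
  toFun v := (fun i => (v.1 i).coeff k, fun i => (v.2 i).coeff k)
  map_add' v w := by ext <;> simp
  map_smul' a v := by ext <;> simp

/-- The constant row with value `v`. -/
noncomputable def cst : Pauli F ι →ₗ[F] PauliRow F ι where
  toFun v := (fun i => LaurentPolynomial.C (v.1 i), fun i => LaurentPolynomial.C (v.2 i))
  map_add' v w := by ext1 <;> ext1 i <;> simp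
  map_smul' a v := by ext1 <;> ext1 i <;> simp [LaurentPolynomial.smul_eq_C_mul]

theorem coeff_T_mul (n k : ℤ) (f : F[T;T⁻¹]) : (T n * f).coeff k = f.coeff (k - n) := by
  simp [T, -single_eq_C_mul_T, -T_mul, AddMonoidAlgebra.coeff_single_mul_apply, neg_add_eq_sub]

theorem coeff_C_mul (a : F) (k : ℤ) (f : F[T;T⁻¹]) :
    (LaurentPolynomial.C a * f).coeff k = a * f.coeff k := by
  rw [← LaurentPolynomial.smul_eq_C_mul]; simp

theorem coeff_mul_C (a : F) (k : ℤ) (f : F[T;T⁻¹]) :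
    (f * LaurentPolynomial.C a).coeff k = f.coeff k * a := by
  rw [mul_comm, coeff_C_mul, mul_comm]

theorem ext_coef {x y : PauliRow F ι} (h : ∀ k, coef k x = coef k y) : x = y := by
  ext i k
  · exact congrFun (congrArg Prod.fst (h k)) i
  · exact congrFun (congrArg Prod.snd (h k)) i

theorem coef_T_smul (n k : ℤ) (x : PauliRow F ι) : coef k ((T n : F[T;T⁻¹]) • x) = coef (k - n) x := by
  ext i <;> simp [coef, -T_mul, coeff_T_mul]

theorem coef_smul_cst (k : ℤ) (f : F[T;T⁻¹]) (u : Pauli F ι) :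
    coef k (f • cst u) = f.coeff k • u := by
  ext i <;> simp [coef, cst, coeff_mul_C]

theorem coef_cst (k : ℤ) (u : Pauli F ι) : coef k (cst u) = if k = 0 then u else 0 := by
  ext i <;> simp [coef, cst] <;> split_ifs <;> rfl

theorem coef_zero_cst (u : Pauli F ι) : coef 0 (cst u) = u := by simp [coef_cst]

variable [Fintype ι]

/-- The skew-Hermitian form `x(D) z'(1/D)ᵗ - z(D) x'(1/D)ᵗ`. -/
noncomputable def form (v w : PauliRow F ι) : F[T;T⁻¹] :=
  ∑ k, (v.1 k * invert (w.2 k) - v.2 k * invert (w.1 k))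

/-- The symplectic form on a single frame. -/
def sympl : LinearMap.BilinForm F (Pauli F ι) :=
  LinearMap.mk₂ F (fun v w => ∑ k, (v.1 k * w.2 k - v.2 k * w.1 k))
    (fun a b c => by simp only [← Finset.sum_add_distrib]; congr! 1; simp; ring)
    (fun a b c => by simp only [smul_eq_mul, Finset.mul_sum]; congr! 1; simp; ring)
    (fun a b c => by simp only [← Finset.sum_add_distrib]; congr! 1; simp; ring)
    (fun a b c => by simp only [smul_eq_mul, Finset.mul_sum]; congr! 1; simp; ring)

theorem sympl_apply (v w : Pauli F ι) :
    sympl v w = ∑ k, (v.1 k * w.2 k - v.2 k * w.1 k) := rfl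

theorem sympl_self (v : Pauli F ι) : sympl v v = 0 := by
  rw [sympl_apply]; exact Finset.sum_eq_zero fun k _ => by ring

theorem sympl_swap (v w : Pauli F ι) : sympl v w = - sympl w v := by
  simp only [sympl_apply, ← Finset.sum_neg_distrib]; congr! 1; ring

theorem sympl_isRefl : (sympl (F := F) (ι := ι)).IsRefl := fun v w h => by
  rw [sympl_swap, h, neg_zero]

theorem sympl_nondegenerate : (sympl (F := F) (ι := ι)).Nondegenerate := by
  classical
  have key : ∀ v : Pauli F ι, (∀ w, sympl v w = 0) → v = 0 := by
    intro v hv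
    ext i
    · simpa [sympl_apply, Pi.single_apply] using hv (0, Pi.single i 1)
    · simpa [sympl_apply, Pi.single_apply] using hv (Pi.single i 1, 0)
  refine ⟨key, fun v hv => key v fun w => ?_⟩
  rw [sympl_swap, hv w, neg_zero]

theorem form_add_left (v v' w : PauliRow F ι) : form (v + v') w = form v w + form v' w := by
  simp only [form, ← Finset.sum_add_distrib]; congr! 1; simp; ring

theorem form_smul_left (f : F[T;T⁻¹]) (v w : PauliRow F ι) : form (f • v) w = f * form v w := by
  simp only [form, Finset.mul_sum]; congr! 1; simp; ring

theorem form_swap (v w : PauliRow F ι) : form w v = - invert (form v w) := by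
  have h : ∀ f : F[T;T⁻¹], invert (invert f) = f := involutive_invert
  simp only [form, map_sum, ← Finset.sum_neg_distrib]; congr! 1; simp [h]; ring

theorem form_add_right (v w w' : PauliRow F ι) : form v (w + w') = form v w + form v w' := by
  rw [form_swap, form_add_left, map_add, neg_add, ← form_swap, ← form_swap]

theorem form_smul_right (f : F[T;T⁻¹]) (v w : PauliRow F ι) :
    form v (f • w) = invert f * form v w := by
  rw [form_swap, form_smul_left, map_mul, ← mul_neg, ← form_swap]

/-- `form` as a linear map in its first variable. -/
noncomputable def formLeft (w : PauliRow F ι) : PauliRow F ι →ₗ[F[T;T⁻¹]] F[T;T⁻¹] where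
  toFun v := form v w
  map_add' v v' := form_add_left v v' w
  map_smul' f v := form_smul_left f v w

/-- Pairing with a constant row works coefficient by coefficient. This is the bridge from Laurent
rows to linear algebra over F. -/
theorem coeff_form_cst (x : PauliRow F ι) (u : Pauli F ι) (k : ℤ) :
    (form x (cst u)).coeff k = sympl (coef k x) u := by
  simp only [form, sympl_apply, cst, coef]
  simp [AddMonoidAlgebra.coeff_sum, coeff_mul_C]

theorem form_cst_cst (u v : Pauli F ι) :
    form (cst u) (cst v) = LaurentPolynomial.C (sympl u v) := by
  ext k
  rw [coeff_form_cst, coef_cst, C_apply]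
  split_ifs <;> simp

theorem coeff_mul_eq_zero {f g : F[T;T⁻¹]} (hf : ∀ k, 0 < k → f.coeff k = 0)
    (hg : ∀ k, 0 < k → g.coeff k = 0) {k : ℤ} (hk : 0 < k) : (f * g).coeff k = 0 := by
  classical
  rw [AddMonoidAlgebra.coeff_mul]
  refine Finset.sum_eq_zero fun a ha => Finset.sum_eq_zero fun b hb => ?_
  dsimp only
  split_ifs with h
  · rcases lt_or_ge 0 a with h' | h'
    · simp [hf a h']
    · simp [hg b (by lia)]
  · rfl

/-- The form replaces D by 1/D in its second argument, so both factors of every term have only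
nonpositive powers. -/
theorem coeff_form_eq_zero {x t : PauliRow F ι} (hx : ∀ k, 0 < k → coef k x = 0)
    (ht : ∀ k, k < 0 → coef k t = 0) {k : ℤ} (hk : 0 < k) : (form x t).coeff k = 0 := by
  have h1 : ∀ i k, 0 < k → (x.1 i).coeff k = 0 := fun i k h =>
    congrFun (congrArg Prod.fst (hx k h)) i
  have h2 : ∀ i k, 0 < k → (x.2 i).coeff k = 0 := fun i k h =>
    congrFun (congrArg Prod.snd (hx k h)) i
  have h3 : ∀ i k, 0 < k → (invert (t.1 i)).coeff k = 0 := fun i k h => by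
    rw [invert_apply]; exact congrFun (congrArg Prod.fst (ht (-k) (by lia))) i
  have h4 : ∀ i k, 0 < k → (invert (t.2 i)).coeff k = 0 := fun i k h => by
    rw [invert_apply]; exact congrFun (congrArg Prod.snd (ht (-k) (by lia))) i
  simp only [form, AddMonoidAlgebra.coeff_sum, Finsupp.coe_finsetSum, Finset.sum_apply]
  refine Finset.sum_eq_zero fun i _ => ?_
  rw [AddMonoidAlgebra.coeff_sub, Finsupp.sub_apply, coeff_mul_eq_zero (h1 i) (h4 i) hk,
    coeff_mul_eq_zero (h2 i) (h3 i) hk, sub_zero]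

end Form

/-! ### Gates as isometries, and their cost in time steps. -/

section Action

variable {F ι : Type*} [Field F] [DecidableEq ι]

theorem Gate.act_add (g : Gate F ι) (v w : PauliRow F ι) : g.act (v + w) = g.act v + g.act w := by
  cases g <;> ext1 <;> ext1 i <;> simp [Gate.act, Function.update_apply, -T_mul] <;>
    split_ifs <;> first | rfl | ring

theorem Gate.act_smul (g : Gate F ι) (f : F[T;T⁻¹]) (v : PauliRow F ι) :
    g.act (f • v) = f • g.act v := by
  cases g <;> ext1 <;> ext1 i <;> simp [Gate.act, Function.update_apply, -T_mul] <;>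
    split_ifs <;> first | rfl | ring

/-- The action of a gate as a linear map. -/
noncomputable def Gate.lin (g : Gate F ι) : PauliRow F ι →ₗ[F[T;T⁻¹]] PauliRow F ι where
  toFun := g.act
  map_add' := g.act_add
  map_smul' := g.act_smul

theorem Layer.act_add (L : Layer F ι) (v w : PauliRow F ι) :
    L.act (v + w) = L.act v + L.act w := by
  unfold Layer.act
  induction L.gates generalizing v w with
  | nil => rfl
  | cons g l ih => simp only [List.foldl_cons, Gate.act_add, ih]

theorem Layer.act_smul (L : Layer F ι) (f : F[T;T⁻¹]) (v : PauliRow F ι) :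
    L.act (f • v) = f • L.act v := by
  unfold Layer.act
  induction L.gates generalizing v with
  | nil => rfl
  | cons g l ih => simp only [List.foldl_cons, Gate.act_smul, ih]

theorem Circuit.act_cons (L : Layer F ι) (c : Circuit F ι) (v : PauliRow F ι) :
    Circuit.act (L :: c) v = Circuit.act c (L.act v) := rfl

theorem Circuit.act_append (c c' : Circuit F ι) (v : PauliRow F ι) :
    Circuit.act (c ++ c') v = Circuit.act c' (Circuit.act c v) := by
  simp [Circuit.act, List.foldl_append]

/-- The action of a circuit as a linear map. -/
noncomputable def Circuit.lin (c : Circuit F ι) : PauliRow F ι →ₗ[F[T;T⁻¹]] PauliRow F ι where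
  toFun := c.act
  map_add' v w := by
    induction c generalizing v w with
    | nil => rfl
    | cons L c ih => simp only [Circuit.act_cons, Layer.act_add, ih]
  map_smul' f v := by
    induction c generalizing v with
    | nil => rfl
    | cons L c ih => simp only [Circuit.act_cons, Layer.act_smul, ih, RingHom.id_apply]

theorem Circuit.lin_apply (c : Circuit F ι) (v : PauliRow F ι) : c.lin v = c.act v := rfl

omit [DecidableEq ι] in
theorem Circuit.depth_append (c c' : Circuit F ι) :
    Circuit.depth (c ++ c') = Circuit.depth c + Circuit.depth c' := by
  simp [Circuit.depth]

theorem Circuit.transforms_iff {ρ : Type*} (c : Circuit F ι) (S S' : Stabilizer F ρ ι) :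
    c.Transforms S S' ↔ S.rowSpace.map c.lin = S'.rowSpace := by
  rw [Circuit.Transforms, Stabilizer.rowSpace.eq_1 S, Submodule.map_span, ← Set.range_comp]
  rfl

/-- The module `M` is the stabilizer obtained from some trivial `X`-only stabilizer with `r`
ancillae by a circuit of depth at most `d`. -/
def Encodable (r d : ℕ) (M : Submodule F[T;T⁻¹] (PauliRow F ι)) : Prop :=
  ∃ (a : Fin r ↪ ι) (c : Circuit F ι), c.depth ≤ d ∧
    (Stabilizer.trivialX (F := F) a).rowSpace.map c.lin = M

/-- The map `φ` can be implemented at a cost of at most `k` time steps, up to delays. -/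
def Realizable (k : ℕ) (φ : PauliRow F ι →ₗ[F[T;T⁻¹]] PauliRow F ι) : Prop :=
  ∀ (r d : ℕ) (M : Submodule F[T;T⁻¹] (PauliRow F ι)), Encodable r d M →
    Encodable r (d + k) (M.map φ)

theorem Encodable.mono {r d d' : ℕ} {M : Submodule F[T;T⁻¹] (PauliRow F ι)}
    (h : Encodable r d M) (hd : d ≤ d') : Encodable r d' M := by
  obtain ⟨a, c, hc, hM⟩ := h
  exact ⟨a, c, hc.trans hd, hM⟩

theorem Realizable.mono {k k' : ℕ} {φ : PauliRow F ι →ₗ[F[T;T⁻¹]] PauliRow F ι}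
    (h : Realizable k φ) (hk : k ≤ k') : Realizable k' φ :=
  fun r d M hM => (h r d M hM).mono (by lia)

theorem Realizable.comp {k k' : ℕ} {φ ψ : PauliRow F ι →ₗ[F[T;T⁻¹]] PauliRow F ι}
    (hψ : Realizable k' ψ) (hφ : Realizable k φ) : Realizable (k + k') (ψ ∘ₗ φ) := by
  intro r d M hM
  rw [Submodule.map_comp, ← add_assoc]
  exact hψ _ _ _ (hφ _ _ _ hM)

theorem Realizable.gate (g : Gate F ι) : Realizable g.duration g.lin := by
  rintro r d M ⟨a, c, hc, rfl⟩
  refine ⟨a, c ++ [⟨[g], List.pairwise_singleton _ _⟩], ?_, ?_⟩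
  · rw [Circuit.depth_append]
    simpa [Circuit.depth, Layer.duration] using hc
  · rw [← Submodule.map_comp]
    congr 1
    exact LinearMap.ext fun v => Circuit.act_append c _ v

theorem realizable_id (k : ℕ) :
    Realizable k (LinearMap.id : PauliRow F ι →ₗ[F[T;T⁻¹]] PauliRow F ι) :=
  fun r d M hM => by rw [Submodule.map_id]; exact hM.mono (by lia)

variable [Fintype ι]

/-- An isometry that can be implemented together with its inverse at a cost of `k` time steps. -/
structure Implements (k : ℕ) (φ : PauliRow F ι ≃ₗ[F[T;T⁻¹]] PauliRow F ι) : Prop where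
  fwd : Realizable k φ.toLinearMap
  bwd : Realizable k φ.symm.toLinearMap
  isom : ∀ v w, form (φ v) (φ w) = form v w

theorem Implements.symm {k : ℕ} {φ : PauliRow F ι ≃ₗ[F[T;T⁻¹]] PauliRow F ι}
    (h : Implements k φ) : Implements k φ.symm :=
  ⟨h.bwd, h.fwd, fun v w => by rw [← h.isom]; simp⟩

theorem Implements.mono {k k' : ℕ} {φ : PauliRow F ι ≃ₗ[F[T;T⁻¹]] PauliRow F ι}
    (h : Implements k φ) (hk : k ≤ k') : Implements k' φ :=
  ⟨h.fwd.mono hk, h.bwd.mono hk, h.isom⟩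

theorem Implements.trans {k k' : ℕ} {φ ψ : PauliRow F ι ≃ₗ[F[T;T⁻¹]] PauliRow F ι}
    (hφ : Implements k φ) (hψ : Implements k' ψ) : Implements (k + k') (φ.trans ψ) :=
  ⟨hψ.fwd.comp hφ.fwd, (hφ.bwd.comp hψ.bwd).mono (by lia), fun v w => by
    rw [LinearEquiv.trans_apply, LinearEquiv.trans_apply, hψ.isom, hφ.isom]⟩

theorem implements_refl (k : ℕ) :
    Implements k (LinearEquiv.refl F[T;T⁻¹] (PauliRow F ι)) :=
  ⟨realizable_id k, realizable_id k, fun _ _ => rfl⟩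

/-- The Fourier transform on qudit `i`. -/
noncomputable def dftEquiv (i : ι) : PauliRow F ι ≃ₗ[F[T;T⁻¹]] PauliRow F ι :=
  LinearEquiv.ofLinearMap (Gate.dft i).lin ((Gate.dft i).lin ∘ₗ (Gate.mul (-1) i).lin)
    (by
      refine LinearMap.ext fun v => ?_
      ext1 <;> ext1 j <;> by_cases h : j = i <;>
        simp [Gate.lin, Gate.act, h])
    (by
      refine LinearMap.ext fun v => ?_
      ext1 <;> ext1 j <;> by_cases h : j = i <;>
        simp [Gate.lin, Gate.act, h])

omit [Fintype ι] in
theorem dftEquiv_apply (i : ι) (v : PauliRow F ι) :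
    dftEquiv i v = (Function.update v.1 i (v.2 i), Function.update v.2 i (-v.1 i)) := rfl

omit [Fintype ι] in
theorem dftEquiv_symm_apply (i : ι) (v : PauliRow F ι) :
    (dftEquiv i).symm v = (Function.update v.1 i (-v.2 i), Function.update v.2 i (v.1 i)) := by
  rw [LinearEquiv.symm_apply_eq, dftEquiv_apply]
  ext1 <;> ext1 j <;> by_cases h : j = i <;> simp [h]

/-- The square of the transform is -1 on its qudit, so the inverse needs one extra multiplication
gate; hence cost 2. -/
theorem implements_dft (i : ι) : Implements 2 (dftEquiv (F := F) i) := by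
  refine ⟨(Realizable.gate (Gate.dft i)).mono (by simp [Gate.duration]),
    (Realizable.gate (Gate.dft i)).comp (Realizable.gate (Gate.mul (-1) i)), fun v w => ?_⟩
  unfold form
  refine Finset.sum_congr rfl fun k _ => ?_
  by_cases h : k = i <;> simp [dftEquiv_apply, h]
  ring

/-- The multiplication gate on qudit `i`. -/
noncomputable def mulEquiv (γ : Fˣ) (i : ι) : PauliRow F ι ≃ₗ[F[T;T⁻¹]] PauliRow F ι :=
  LinearEquiv.ofLinearMap (Gate.mul γ i).lin (Gate.mul γ⁻¹ i).lin
    (by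
      refine LinearMap.ext fun v => ?_
      ext1 <;> ext1 j <;> by_cases h : j = i <;>
        simp [Gate.lin, Gate.act, h, ← mul_assoc, ← map_mul])
    (by
      refine LinearMap.ext fun v => ?_
      ext1 <;> ext1 j <;> by_cases h : j = i <;>
        simp [Gate.lin, Gate.act, h, ← mul_assoc, ← map_mul])

omit [Fintype ι] in
theorem mulEquiv_apply (γ : Fˣ) (i : ι) (v : PauliRow F ι) :
    mulEquiv γ i v = (Function.update v.1 i (LaurentPolynomial.C (↑γ⁻¹ : F) * v.1 i),
        Function.update v.2 i (LaurentPolynomial.C (γ : F) * v.2 i)) := rfl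

theorem implements_mul (γ : Fˣ) (i : ι) : Implements 1 (mulEquiv γ i) := by
  refine ⟨Realizable.gate (Gate.mul γ i), Realizable.gate (Gate.mul γ⁻¹ i), fun v w => ?_⟩
  unfold form
  refine Finset.sum_congr rfl fun k _ => ?_
  have h1 : LaurentPolynomial.C (↑γ⁻¹ : F) * LaurentPolynomial.C (γ : F) = 1 := by
    rw [← map_mul]; simp
  by_cases h : k = i
  · subst h
    simp only [mulEquiv_apply, Function.update_self, map_mul, invert_C]
    linear_combination (v.1 k * invert (w.2 k) - v.2 k * invert (w.1 k)) * h1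
  · simp [mulEquiv_apply, h]

/-- The map `z i ↦ z i + h * x i`. -/
noncomputable def shear (i : ι) (h : F[T;T⁻¹]) : PauliRow F ι ≃ₗ[F[T;T⁻¹]] PauliRow F ι where
  toFun v := (v.1, Function.update v.2 i (v.2 i + h * v.1 i))
  invFun v := (v.1, Function.update v.2 i (v.2 i - h * v.1 i))
  map_add' v w := by
    ext1 <;> ext1 j <;> by_cases e : j = i <;> simp [e]; ring
  map_smul' f v := by
    ext1 <;> ext1 j <;> by_cases e : j = i <;> simp [e]; ring
  left_inv v := by simp
  right_inv v := by simp

omit [Fintype ι] in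
theorem shear_apply (i : ι) (h : F[T;T⁻¹]) (v : PauliRow F ι) :
    shear i h v = (v.1, Function.update v.2 i (v.2 i + h * v.1 i)) := rfl

omit [Fintype ι] in
theorem shear_symm (i : ι) (h : F[T;T⁻¹]) : (shear i h).symm = shear i (-h) := by
  ext1 v
  rw [shear_apply, neg_mul, ← sub_eq_add_neg]; rfl

omit [Fintype ι] in
theorem shear_trans (i : ι) (h h' : F[T;T⁻¹]) :
    (shear i h).trans (shear i h') = shear i (h + h') := by
  ext1 v
  ext1 <;> ext1 j <;> by_cases e : j = i <;> simp [shear_apply, e]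
  ring

theorem form_shear (i : ι) (h : F[T;T⁻¹]) (hh : invert h = h) (v w : PauliRow F ι) :
    form (shear i h v) (shear i h w) = form v w := by
  unfold form
  refine Finset.sum_congr rfl fun k _ => ?_
  by_cases e : k = i <;> simp [shear_apply, e, hh]
  ring

theorem implements_shear_C (i : ι) (γ : F) : Implements 1 (shear i (LaurentPolynomial.C γ)) := by
  refine ⟨Realizable.gate (Gate.phase γ i), ?_, form_shear _ _ (by simp)⟩
  rw [shear_symm, ← map_neg]
  exact Realizable.gate (Gate.phase (-γ) i)

-- Conjugating the controlled phase gate by a multiplication gate scales x by α before and z by α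
-- after it, which produces only square coefficients. The cost is 1 + 2 + 1.
omit [Fintype ι] in
theorem realizable_shear_sq (i : ι) (l : ℤ) (hl : l ≠ 0) (α : F) :
    Realizable 4 (shear i (LaurentPolynomial.C (α ^ 2) * (T l + T (-l)))).toLinearMap := by
  by_cases hα : α = 0
  · convert realizable_id (F := F) (ι := ι) 4
    refine LinearMap.ext fun v => ?_
    simp [shear_apply, hα]
  · have h := ((Realizable.gate (Gate.mul (Units.mk0 α hα) i)).comp
      ((Realizable.gate (Gate.cphase i l hl)).comp
        (Realizable.gate (Gate.mul (Units.mk0 α hα)⁻¹ i))))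
    have e : LaurentPolynomial.C α⁻¹ * LaurentPolynomial.C α = 1 := by
      rw [← map_mul]; simp [hα]
    refine (congrArg (Realizable 4) ?_).mpr h
    refine LinearMap.ext fun v => ?_
    ext1 <;> ext1 j <;> by_cases h : j = i <;>
      simp [shear_apply, Gate.lin, Gate.act, h, -T_mul, -mul_T_assoc]
    · linear_combination - v.1 i * e
    · linear_combination - v.2 i * e

omit [Fintype ι] in
theorem realizable_shear (i : ι) (l : ℤ) (hl : l ≠ 0) {γ α β : F} (h : α ^ 2 + β ^ 2 = γ) :
    Realizable 8 (shear i (LaurentPolynomial.C γ * (T l + T (-l)))).toLinearMap := by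
  have := (realizable_shear_sq i l hl β).comp (realizable_shear_sq i l hl α)
  rwa [← LinearEquiv.coe_trans, shear_trans, ← add_mul, ← map_add, h] at this

-- This frees the shears from the restriction to squares: two of them compose to any coefficient. In
-- characteristic 2 one square is enough.
omit [DecidableEq ι] [Fintype ι] in
theorem exists_sq_add_sq (F : Type*) [Field F] [Finite F] (γ : F) :
    ∃ α β : F, α ^ 2 + β ^ 2 = γ := by
  have := Fintype.ofFinite F
  by_cases hF : ringChar F = 2
  · obtain ⟨a, ha⟩ := FiniteField.isSquare_of_char_two hF γ
    exact ⟨a, 0, by rw [ha]; ring⟩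
  · have := FiniteField.exists_root_sum_quadratic (R := F) (f := Polynomial.X ^ 2)
      (g := Polynomial.X ^ 2 - Polynomial.C γ) (by simp)
      (by rw [Polynomial.degree_X_pow_sub_C (by norm_num)]; rfl)
      (FiniteField.odd_card_of_char_ne_two hF)
    obtain ⟨a, b, hab⟩ := this
    refine ⟨a, b, ?_⟩
    simp at hab
    linear_combination hab

theorem implements_shear [Finite F] (i : ι) (l : ℤ) (hl : l ≠ 0) (γ : F) :
    Implements 8 (shear i (LaurentPolynomial.C γ * (T l + T (-l)))) := by
  obtain ⟨α, β, h⟩ := exists_sq_add_sq F γ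
  obtain ⟨α', β', h'⟩ := exists_sq_add_sq F (-γ)
  refine ⟨realizable_shear i l hl h, ?_, form_shear _ _ (by simp [add_comm])⟩
  rw [shear_symm, ← neg_mul, ← map_neg]
  exact realizable_shear i l hl h'

/-- The map `x j ↦ x j + f(D) * x i`, `z i ↦ z i - f(1/D) * z j`. -/
noncomputable def addEquiv (i j : ι) (hij : i ≠ j) (f : F[T;T⁻¹]) :
    PauliRow F ι ≃ₗ[F[T;T⁻¹]] PauliRow F ι where
  toFun v := (Function.update v.1 j (v.1 j + f * v.1 i),
    Function.update v.2 i (v.2 i - invert f * v.2 j))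
  invFun v := (Function.update v.1 j (v.1 j - f * v.1 i),
    Function.update v.2 i (v.2 i + invert f * v.2 j))
  map_add' v w := by
    ext1 <;> ext1 k
    · by_cases e : k = j <;> simp [e]; ring
    · by_cases e : k = i <;> simp [e]; ring
  map_smul' g v := by
    ext1 <;> ext1 k
    · by_cases e : k = j <;> simp [e]; ring
    · by_cases e : k = i <;> simp [e]; ring
  left_inv v := by simp [hij, hij.symm]
  right_inv v := by simp [hij, hij.symm]

omit [Fintype ι] in
theorem addEquiv_apply (i j : ι) (hij : i ≠ j) (f : F[T;T⁻¹]) (v : PauliRow F ι) :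
    addEquiv i j hij f v = (Function.update v.1 j (v.1 j + f * v.1 i),
      Function.update v.2 i (v.2 i - invert f * v.2 j)) := rfl

omit [Fintype ι] in
theorem addEquiv_symm (i j : ι) (hij : i ≠ j) (f : F[T;T⁻¹]) :
    (addEquiv i j hij f).symm = addEquiv i j hij (-f) := by
  ext1 v
  rw [addEquiv_apply, map_neg, neg_mul, neg_mul, ← sub_eq_add_neg, sub_neg_eq_add]; rfl

theorem form_addEquiv (i j : ι) (hij : i ≠ j) (f : F[T;T⁻¹]) (v w : PauliRow F ι) :
    form (addEquiv i j hij f v) (addEquiv i j hij f w) = form v w := by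
  have hf : invert (invert f) = f := involutive_invert f
  -- The terms at the two qudits are not preserved separately; their changes are opposite and cancel
  -- in the sum.
  have key : ∀ k, ((addEquiv i j hij f v).1 k * invert ((addEquiv i j hij f w).2 k)
        - (addEquiv i j hij f v).2 k * invert ((addEquiv i j hij f w).1 k)) =
      (v.1 k * invert (w.2 k) - v.2 k * invert (w.1 k))
      + ((if k = j then f * v.1 i * invert (w.2 j) - v.2 j * invert f * invert (w.1 i) else 0)
      - (if k = i then f * v.1 i * invert (w.2 j) - v.2 j * invert f * invert (w.1 i) else 0)) := by
    intro k
    by_cases h1 : k = j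
    · subst h1
      simp [addEquiv_apply, hij.symm]; ring
    · by_cases h2 : k = i
      · subst h2
        simp [addEquiv_apply, hij, hf]; ring
      · simp [addEquiv_apply, h1, h2]
  unfold form
  simp only [key, Finset.sum_add_distrib, Finset.sum_sub_distrib, Finset.sum_ite_eq',
    Finset.mem_univ, if_true, sub_self, add_zero]

omit [Fintype ι] in
theorem realizable_add (i j : ι) (hij : i ≠ j) (γ : F) (l : ℤ) :
    Realizable 3 (addEquiv i j hij (LaurentPolynomial.C γ * T l)).toLinearMap := by
  by_cases hα : γ = 0
  · convert realizable_id (F := F) (ι := ι) 3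
    refine LinearMap.ext fun v => ?_
    simp [addEquiv_apply, hα]
  · have h := ((Realizable.gate (Gate.mul (Units.mk0 γ hα) i)).comp
      ((Realizable.gate (Gate.add i j hij l)).comp
        (Realizable.gate (Gate.mul (Units.mk0 γ hα)⁻¹ i))))
    have e : LaurentPolynomial.C γ⁻¹ * LaurentPolynomial.C γ = 1 := by
      rw [← map_mul]; simp [hα]
    refine (congrArg (Realizable 3) ?_).mpr h
    refine LinearMap.ext fun v => ?_
    ext1 <;> ext1 k <;> by_cases h1 : k = i <;> by_cases h2 : k = j <;>
      first
      | exact absurd (h1.symm.trans h2) hij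
      | simp [addEquiv_apply, Gate.lin, Gate.act, h1, h2, hij, hij.symm, -T_mul, -mul_T_assoc]
    · linear_combination - v.1 i * e
    · ring
    · linear_combination - v.2 i * e

theorem implements_add (i j : ι) (hij : i ≠ j) (γ : F) (l : ℤ) :
    Implements 3 (addEquiv i j hij (LaurentPolynomial.C γ * T l)) := by
  refine ⟨realizable_add i j hij γ l, ?_, form_addEquiv _ _ _ _⟩
  rw [addEquiv_symm, ← neg_mul, ← map_neg]
  exact realizable_add i j hij (-γ) l

end Action

/-! ### Delays of single qudits come for free. -/

section Delay

variable {F ι : Type*} [Field F] [DecidableEq ι]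

/-- The delay of qudit `j` by `k` frames. -/
noncomputable def delay (j : ι) (k : ℤ) : PauliRow F ι →ₗ[F[T;T⁻¹]] PauliRow F ι where
  toFun v := (fun i => T (if i = j then k else 0) * v.1 i,
    fun i => T (if i = j then k else 0) * v.2 i)
  map_add' v w := by ext1 <;> ext1 i <;> simp [-T_mul, mul_add]
  map_smul' f v := by ext1 <;> ext1 i <;> simp [-T_mul, mul_left_comm]

theorem delay_apply (j : ι) (k : ℤ) (v : PauliRow F ι) :
    delay j k v = (fun i => T (if i = j then k else 0) * v.1 i,
      fun i => T (if i = j then k else 0) * v.2 i) := rfl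

/-- The delay of qudit `j` as an equivalence. -/
noncomputable def delayEquiv (j : ι) (k : ℤ) : PauliRow F ι ≃ₗ[F[T;T⁻¹]] PauliRow F ι :=
  LinearEquiv.ofLinearMap (delay j k) (delay j (-k))
    (by
      refine LinearMap.ext fun v => ?_
      ext1 <;> ext1 i <;> by_cases h : i = j <;>
        simp [delay_apply, h, -T_mul, ← mul_assoc, ← T_add, -mul_T_assoc])
    (by
      refine LinearMap.ext fun v => ?_
      ext1 <;> ext1 i <;> by_cases h : i = j <;>
        simp [delay_apply, h, -T_mul, ← mul_assoc, ← T_add, -mul_T_assoc])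

/-- The gate `g` conjugated by the delay of qudit `j`. -/
def Gate.delayed (j : ι) (k : ℤ) : Gate F ι → Gate F ι
  | .add a b h l => .add a b h (l + (if b = j then k else 0) - (if a = j then k else 0))
  | .dft i => .dft i
  | .mul γ i => .mul γ i
  | .phase γ i => .phase γ i
  | .cphase i l h => .cphase i l h

theorem Gate.wires_delayed (j : ι) (k : ℤ) (g : Gate F ι) : (g.delayed j k).wires = g.wires := by
  cases g <;> rfl

theorem Gate.duration_delayed (j : ι) (k : ℤ) (g : Gate F ι) :
    (g.delayed j k).duration = g.duration := by
  cases g <;> rfl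

/-- Gates on a single qudit, controlled phases included, commute with a delay. Only the frame offset
of an ADD gate has to be adjusted. -/
theorem Gate.act_delayed (j : ι) (k : ℤ) (g : Gate F ι) (v : PauliRow F ι) :
    (g.delayed j k).act (delay j k v) = delay j k (g.act v) := by
  cases g with
  | add a b h l =>
    have e1 : (T (l + (if b = j then k else 0) - (if a = j then k else 0)) : F[T;T⁻¹])
        * T (if a = j then k else 0) = T (if b = j then k else 0) * T l := by
      rw [← T_add, ← T_add]; congr 1; ring
    have e2 : (T (-(l + (if b = j then k else 0) - (if a = j then k else 0))) : F[T;T⁻¹])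
        * T (if b = j then k else 0) = T (if a = j then k else 0) * T (-l) := by
      rw [← T_add, ← T_add]; congr 1; ring
    ext1 <;> ext1 i
    · by_cases hb : i = b
      · subst hb
        simp only [Gate.delayed, Gate.act, delay_apply, Function.update_self]
        linear_combination v.1 a * e1
      · simp [Gate.delayed, Gate.act, delay_apply, hb, -T_mul]
    · by_cases hb : i = a
      · subst hb
        simp only [Gate.delayed, Gate.act, delay_apply, Function.update_self]
        linear_combination -v.2 b * e2
      · simp [Gate.delayed, Gate.act, delay_apply, hb, -T_mul]
  | dft i =>
    ext1 <;> ext1 m <;> by_cases hb : m = i <;>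
      simp [Gate.delayed, Gate.act, delay_apply, hb, -T_mul, -mul_T_assoc]
  | mul γ i =>
    ext1 <;> ext1 m <;> by_cases hb : m = i <;>
      simp [Gate.delayed, Gate.act, delay_apply, hb, -T_mul, -mul_T_assoc] <;> ring
  | phase γ i =>
    ext1 <;> ext1 m <;> by_cases hb : m = i <;>
      simp [Gate.delayed, Gate.act, delay_apply, hb, -T_mul, -mul_T_assoc]; ring
  | cphase i l h =>
    ext1 <;> ext1 m <;> by_cases hb : m = i <;>
      simp [Gate.delayed, Gate.act, delay_apply, hb, -T_mul, -mul_T_assoc]; ring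

/-- A layer conjugated by the delay of qudit `j`. -/
def Layer.delayed (j : ι) (k : ℤ) (L : Layer F ι) : Layer F ι where
  gates := L.gates.map (Gate.delayed j k)
  disjoint := by
    refine List.Pairwise.map _ (fun g h hgh => ?_) L.disjoint
    rwa [Gate.wires_delayed, Gate.wires_delayed]

theorem Layer.duration_delayed (j : ι) (k : ℤ) (L : Layer F ι) :
    (L.delayed j k).duration = L.duration := by
  simp [Layer.duration, Layer.delayed, Function.comp_def, Gate.duration_delayed]

theorem Layer.act_delayed (j : ι) (k : ℤ) (L : Layer F ι) (v : PauliRow F ι) :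
    (L.delayed j k).act (delay j k v) = delay j k (L.act v) := by
  simp only [Layer.act, Layer.delayed]
  induction L.gates generalizing v with
  | nil => rfl
  | cons g l ih => simp only [List.map_cons, List.foldl_cons, Gate.act_delayed, ih]

theorem Circuit.exists_delayed (j : ι) (k : ℤ) (c : Circuit F ι) :
    ∃ c' : Circuit F ι, c'.depth = c.depth ∧ ∀ v, c'.act (delay j k v) = delay j k (c.act v) := by
  refine ⟨List.map (Layer.delayed j k) c, ?_, fun v => ?_⟩
  · simp [Circuit.depth, Function.comp_def, Layer.duration_delayed]
  · induction c generalizing v with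
    | nil => rfl
    | cons L c ih => simp only [List.map_cons, Circuit.act_cons, Layer.act_delayed, ih]

theorem map_delay_trivialX_le {r : ℕ} (a : Fin r ↪ ι) (j : ι) (k : ℤ) :
    (Stabilizer.trivialX (F := F) a).rowSpace.map (delay j k) ≤
      (Stabilizer.trivialX (F := F) a).rowSpace := by
  rw [Stabilizer.rowSpace, Submodule.map_span_le]
  rintro _ ⟨i, rfl⟩
  have : delay j k ((Stabilizer.trivialX (F := F) a).row i) =
      (T (if a i = j then k else 0) : F[T;T⁻¹]) • (Stabilizer.trivialX (F := F) a).row i := by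
    ext1 <;> ext1 m <;> by_cases h : m = a i <;>
      simp [delay_apply, Stabilizer.row, Stabilizer.trivialX, h]
  rw [this]
  exact Submodule.smul_mem _ _ (Submodule.subset_span ⟨i, rfl⟩)

theorem map_delay_trivialX {r : ℕ} (a : Fin r ↪ ι) (j : ι) (k : ℤ) :
    (Stabilizer.trivialX (F := F) a).rowSpace.map (delay j k) =
      (Stabilizer.trivialX (F := F) a).rowSpace := by
  refine le_antisymm (map_delay_trivialX_le a j k) fun x hx => ?_
  refine ⟨delay j (-k) x, map_delay_trivialX_le a j (-k) ⟨x, hx, rfl⟩, ?_⟩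
  exact (delayEquiv j k).apply_symm_apply x

/-- The delay is moved back through the circuit to the ancillae. There it multiplies each generator
by a power of D, a unit, and leaves the module unchanged. -/
theorem realizable_delay (j : ι) (k : ℤ) : Realizable 0 (delay (F := F) j k) := by
  rintro r d M ⟨a, c, hc, rfl⟩
  obtain ⟨c', h1, h2⟩ := c.exists_delayed j k
  refine ⟨a, c', h1 ▸ hc, ?_⟩
  conv_lhs => rw [← map_delay_trivialX a j k]
  rw [← Submodule.map_comp, ← Submodule.map_comp]
  have : c'.lin ∘ₗ delay j k = delay j k ∘ₗ c.lin := LinearMap.ext h2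
  rw [this]

theorem implements_delay [Fintype ι] (j : ι) (k : ℤ) : Implements 0 (delayEquiv (F := F) j k) := by
  refine ⟨realizable_delay j k, realizable_delay j (-k), fun v w => ?_⟩
  unfold form
  refine Finset.sum_congr rfl fun i _ => ?_
  change T _ * v.1 i * invert (T _ * w.2 i) - T _ * v.2 i * invert (T _ * w.1 i) = _
  have e : (T (if i = j then k else 0) : F[T;T⁻¹]) * T (-(if i = j then k else 0)) = 1 := by
    rw [← T_add]; simp
  simp only [map_mul, invert_T]
  linear_combination (v.1 i * invert (w.2 i) - v.2 i * invert (w.1 i)) * e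

end Delay

/-! ### Symplectic elimination within a frame, and the isometries obtained by conjugation. -/

section Clifford

variable {F ι : Type*} [Field F] [DecidableEq ι]

/-- The operator `X` on qudit `j`. -/
def pauliX (j : ι) : Pauli F ι := (Pi.single j 1, 0)

/-- The operator `Z` on qudit `j`. -/
def pauliZ (j : ι) : Pauli F ι := (0, Pi.single j 1)

theorem equiv_smul {F ι : Type*} [Field F] (φ : PauliRow F ι ≃ₗ[F[T;T⁻¹]] PauliRow F ι) (a : F)
    (x : PauliRow F ι) : φ (a • x) = a • φ x :=
  φ.toLinearMap.map_smul_of_tower a x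

theorem dftEquiv_cst (i : ι) (u : Pauli F ι) : dftEquiv i (cst u) =
    cst (Function.update u.1 i (u.2 i), Function.update u.2 i (-u.1 i)) := by
  ext1 <;> ext1 j <;> by_cases h : j = i <;> simp [dftEquiv_apply, cst, h]

theorem dftEquiv_symm_cst (i : ι) (u : Pauli F ι) : (dftEquiv i).symm (cst u) =
    cst (Function.update u.1 i (-u.2 i), Function.update u.2 i (u.1 i)) := by
  ext1 <;> ext1 j <;> by_cases h : j = i <;> simp [dftEquiv_symm_apply, cst, h]

theorem mulEquiv_cst (γ : Fˣ) (i : ι) (u : Pauli F ι) : mulEquiv γ i (cst u) =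
    cst (Function.update u.1 i (↑γ⁻¹ * u.1 i), Function.update u.2 i (γ * u.2 i)) := by
  ext1 <;> ext1 j <;> by_cases h : j = i <;> simp [mulEquiv_apply, cst, h]

theorem shear_cst (γ : F) (i : ι) (u : Pauli F ι) : shear i (LaurentPolynomial.C γ) (cst u) =
    cst (u.1, Function.update u.2 i (u.2 i + γ * u.1 i)) := by
  ext1 <;> ext1 j <;> by_cases h : j = i <;> simp [shear_apply, cst, h]

theorem addEquiv_cst (i j : ι) (hij : i ≠ j) (γ : F) (u : Pauli F ι) :
    addEquiv i j hij (LaurentPolynomial.C γ) (cst u) =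
      cst (Function.update u.1 j (u.1 j + γ * u.1 i), Function.update u.2 i (u.2 i - γ * u.2 j)) := by
  ext1 <;> ext1 k <;> by_cases h1 : k = i <;> by_cases h2 : k = j <;>
    simp [addEquiv_apply, cst, Function.update_apply, h1, h2, hij, hij.symm]

variable [Fintype ι]

/-- An isometry implemented by gates that act within each frame in the same way. -/
structure IsClifford (k : ℕ) (φ : PauliRow F ι ≃ₗ[F[T;T⁻¹]] PauliRow F ι) : Prop
    extends Implements k φ where
  map_cst : ∀ u, ∃ u', φ (cst u) = cst u'

theorem IsClifford.trans {k k' : ℕ} {φ ψ : PauliRow F ι ≃ₗ[F[T;T⁻¹]] PauliRow F ι}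
    (hφ : IsClifford k φ) (hψ : IsClifford k' ψ) : IsClifford (k + k') (φ.trans ψ) := by
  refine ⟨hφ.toImplements.trans hψ.toImplements, fun u => ?_⟩
  obtain ⟨u', hu'⟩ := hφ.map_cst u
  obtain ⟨u'', hu''⟩ := hψ.map_cst u'
  exact ⟨u'', by rw [LinearEquiv.trans_apply, hu', hu'']⟩

theorem IsClifford.mono {k k' : ℕ} {φ : PauliRow F ι ≃ₗ[F[T;T⁻¹]] PauliRow F ι}
    (h : IsClifford k φ) (hk : k ≤ k') : IsClifford k' φ :=
  ⟨h.toImplements.mono hk, h.map_cst⟩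

theorem isClifford_refl (k : ℕ) : IsClifford k (LinearEquiv.refl F[T;T⁻¹] (PauliRow F ι)) :=
  ⟨implements_refl k, fun u => ⟨u, rfl⟩⟩

theorem isClifford_dft (i : ι) : IsClifford 2 (dftEquiv (F := F) i) :=
  ⟨implements_dft i, fun u => ⟨_, dftEquiv_cst i u⟩⟩

theorem isClifford_dft_symm (i : ι) : IsClifford 2 (dftEquiv (F := F) i).symm :=
  ⟨(implements_dft i).symm, fun u => ⟨_, dftEquiv_symm_cst i u⟩⟩

theorem isClifford_mul (γ : Fˣ) (i : ι) : IsClifford 1 (mulEquiv γ i) :=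
  ⟨implements_mul γ i, fun u => ⟨_, mulEquiv_cst γ i u⟩⟩

theorem isClifford_shear (γ : F) (i : ι) : IsClifford 1 (shear i (LaurentPolynomial.C γ)) :=
  ⟨implements_shear_C i γ, fun u => ⟨_, shear_cst γ i u⟩⟩

theorem isClifford_add (i j : ι) (hij : i ≠ j) (γ : F) :
    IsClifford 3 (addEquiv i j hij (LaurentPolynomial.C γ)) := by
  refine ⟨?_, fun u => ⟨_, addEquiv_cst i j hij γ u⟩⟩
  simpa using implements_add i j hij γ 0

theorem IsClifford.sympl_eq {k : ℕ} {φ : PauliRow F ι ≃ₗ[F[T;T⁻¹]] PauliRow F ι}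
    (h : IsClifford k φ) {u u' v v' : Pauli F ι} (hu : φ (cst u) = cst u')
    (hv : φ (cst v) = cst v') : sympl u' v' = sympl u v := by
  have := h.isom (cst u) (cst v)
  rw [hu, hv, form_cst_cst, form_cst_cst] at this
  simpa using congrArg (fun f => f.coeff 0) this

/-- The entry 1 at j is a pivot: an ADD from j to i clears x_i, a Fourier transform brings z_i into
its place, and another ADD clears that. The cost is 3 + 2 + 3. -/
theorem exists_clifford_clear_one {i j : ι} (hij : i ≠ j) (u : Pauli F ι) (hu : u.1 j = 1) :
    ∃ φ : PauliRow F ι ≃ₗ[F[T;T⁻¹]] PauliRow F ι, IsClifford 8 φ ∧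
      φ (cst (pauliZ j)) = cst (pauliZ j) ∧
      (∀ x : PauliRow F ι, x.1 i = 0 → x.2 i = 0 → x.1 j = 0 → x.2 j = 0 → φ x = x) ∧
      ∃ u', φ (cst u) = cst u' ∧ u'.1 j = 1 ∧ u'.1 i = 0 ∧ u'.2 i = 0 ∧
        ∀ m, m ≠ i → m ≠ j → u'.1 m = u.1 m ∧ u'.2 m = u.2 m := by
  refine ⟨((addEquiv j i hij.symm (LaurentPolynomial.C (-u.1 i))).trans (dftEquiv i)).trans
    (addEquiv j i hij.symm (LaurentPolynomial.C (-u.2 i))),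
    ((isClifford_add _ _ _ _).trans (isClifford_dft _)).trans (isClifford_add _ _ _ _),
    ?_, ?_, ?_⟩
  · simp only [LinearEquiv.trans_apply, addEquiv_cst, dftEquiv_cst]
    congr 1
    ext m <;> by_cases h1 : m = i <;> by_cases h2 : m = j <;>
      simp [pauliZ, h1, h2, hij, hij.symm]
  · intro x h1 h2 h3 h4
    simp only [LinearEquiv.trans_apply]
    have e1 : ∀ γ, addEquiv j i hij.symm (LaurentPolynomial.C γ) x = x := fun γ => by
      ext1 <;> simp [addEquiv_apply, h3, h2]
    have e2 : dftEquiv i x = x := by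
      ext1 <;> simp [dftEquiv_apply, h1, h2]
    · rw [e1, e2, e1]
  · simp only [LinearEquiv.trans_apply, addEquiv_cst, dftEquiv_cst]
    refine ⟨_, rfl, ?_, ?_, ?_, fun m h1 h2 => ?_⟩ <;> simp [hij.symm, *]

theorem exists_clifford_clear (j : ι) (s : Finset ι) (hj : j ∉ s) (u : Pauli F ι)
    (hu : u.1 j = 1) :
    ∃ φ : PauliRow F ι ≃ₗ[F[T;T⁻¹]] PauliRow F ι, IsClifford (8 * s.card) φ ∧
      φ (cst (pauliZ j)) = cst (pauliZ j) ∧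
      (∀ x : PauliRow F ι, (∀ i, i = j ∨ i ∈ s → x.1 i = 0 ∧ x.2 i = 0) → φ x = x) ∧
      ∃ u', φ (cst u) = cst u' ∧ u'.1 j = 1 ∧ (∀ i ∈ s, u'.1 i = 0 ∧ u'.2 i = 0) ∧
        ∀ m, m ∉ s → m ≠ j → u'.1 m = u.1 m ∧ u'.2 m = u.2 m := by
  induction s using Finset.induction_on with
  | empty =>
    exact ⟨LinearEquiv.refl _ _, isClifford_refl _, rfl, fun _ _ => rfl, u, rfl, hu, by simp,
      fun _ _ _ => ⟨rfl, rfl⟩⟩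
  | insert i s hi ih =>
    rw [Finset.mem_insert, not_or] at hj
    obtain ⟨φ, h1, h2, h3, u', h4, h5, h6, h7⟩ := ih hj.2
    obtain ⟨ψ, g1, g2, g3, u'', g4, g5, g6, g7, g8⟩ :=
      exists_clifford_clear_one (Ne.symm hj.1) u' h5
    refine ⟨φ.trans ψ, (h1.trans g1).mono (by rw [Finset.card_insert_of_notMem hi]; lia), ?_, ?_,
      u'', ?_, g5, ?_, ?_⟩
    · rw [LinearEquiv.trans_apply, h2, g2]
    · intro x hx
      rw [LinearEquiv.trans_apply, h3 x fun k hk => hx k (by simp; tauto)]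
      have hi' := hx i (by simp)
      have hj' := hx j (by simp)
      exact g3 x hi'.1 hi'.2 hj'.1 hj'.2
    · rw [LinearEquiv.trans_apply, h4, g4]
    · intro k hk
      rcases eq_or_ne k i with rfl | hki
      · exact ⟨g6, g7⟩
      · have hks : k ∈ s := (Finset.mem_insert.1 hk).resolve_left hki
        have := g8 k hki (fun e => hj.2 (e ▸ hks))
        rw [this.1, this.2]
        exact h6 k hks
    · intro m hm hmj
      rw [Finset.mem_insert, not_or] at hm
      have := g8 m hm.1 hmj
      rw [this.1, this.2]
      exact h7 m hm.2 hmj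

/-- After all qudits outside J and j are cleared, a diagonal gate removes the remaining Z-component
at j. No gate touches J, so qudits already finished stay as they are. -/
theorem exists_clifford_pivot (J : Finset ι) (j : ι) (hj : j ∉ J) (u : Pauli F ι)
    (hJ : ∀ i ∈ J, u.1 i = 0 ∧ u.2 i = 0) (hu : u.1 j = 1) :
    ∃ φ : PauliRow F ι ≃ₗ[F[T;T⁻¹]] PauliRow F ι, IsClifford (8 * Fintype.card ι) φ ∧
      φ (cst (pauliZ j)) = cst (pauliZ j) ∧ φ (cst u) = cst (pauliX j) ∧
      (∀ x : PauliRow F ι, (∀ i, i ∉ J → x.1 i = 0 ∧ x.2 i = 0) → φ x = x) := by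
  obtain ⟨φ, h1, h2, h3, u', h4, h5, h6, h7⟩ :=
    exists_clifford_clear j (Finset.univ \ insert j J) (by simp) u hu
  refine ⟨φ.trans (shear j (LaurentPolynomial.C (-u'.2 j))),
    (h1.trans (isClifford_shear _ _)).mono ?_, ?_, ?_, ?_⟩
  · have : (Finset.univ \ insert j J).card < Fintype.card ι :=
      Finset.card_lt_card (by
        rw [Finset.ssubset_univ_iff]; intro h
        have := Finset.mem_univ j
        rw [← h] at this; simp at this)
    lia
  · rw [LinearEquiv.trans_apply, h2, shear_cst]
    congr 1
    ext m <;> by_cases e : m = j <;> simp [pauliZ, e]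
  · rw [LinearEquiv.trans_apply, h4, shear_cst]
    congr 1
    ext m
    · by_cases e : m = j
      · simp [pauliX, e, h5]
      · by_cases e' : m ∈ J
        · simp [pauliX, e, (h7 m (by simp [e']) e).1, hJ m e']
        · simp [pauliX, e, (h6 m (by simp [e, e']))]
    · by_cases e : m = j
      · simp [pauliX, e, h5]
      · by_cases e' : m ∈ J
        · simp [pauliX, e, (h7 m (by simp [e']) e).2, hJ m e']
        · simp [pauliX, e, (h6 m (by simp [e, e']))]
  · intro x hx
    rw [LinearEquiv.trans_apply, h3 x]
    · ext1 <;> simp [shear_apply, hx j hj]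
    · intro i hi
      refine hx i ?_
      rcases hi with rfl | hi
      · exact hj
      · simp at hi; tauto

theorem exists_clifford_to_pauliX (J : Finset ι) (u : Pauli F ι)
    (hJ : ∀ i ∈ J, u.1 i = 0 ∧ u.2 i = 0) (hu : u ≠ 0) :
    ∃ (j : ι) (φ : PauliRow F ι ≃ₗ[F[T;T⁻¹]] PauliRow F ι), j ∉ J ∧
      IsClifford (8 * Fintype.card ι + 3) φ ∧ φ (cst u) = cst (pauliX j) ∧
      (∀ x : PauliRow F ι, (∀ i, i ∉ J → x.1 i = 0 ∧ x.2 i = 0) → φ x = x) := by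
  have hx : ∀ (u : Pauli F ι) (j : ι), (∀ i ∈ J, u.1 i = 0 ∧ u.2 i = 0) → u.1 j ≠ 0 →
      ∃ (φ : PauliRow F ι ≃ₗ[F[T;T⁻¹]] PauliRow F ι), j ∉ J ∧
        IsClifford (8 * Fintype.card ι + 1) φ ∧ φ (cst u) = cst (pauliX j) ∧
        (∀ x : PauliRow F ι, (∀ i, i ∉ J → x.1 i = 0 ∧ x.2 i = 0) → φ x = x) := by
    intro u j hJ hj
    have hjJ : j ∉ J := fun h => hj (hJ j h).1
    obtain ⟨φ, h1, -, h2, h3⟩ := exists_clifford_pivot J j hjJ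
      (Function.update u.1 j (↑(Units.mk0 _ hj)⁻¹ * u.1 j),
        Function.update u.2 j ((Units.mk0 _ hj) * u.2 j))
      (fun i hi => by
        have : i ≠ j := fun e => hjJ (e ▸ hi)
        simp [this, hJ i hi]) (by simp [hj])
    refine ⟨(mulEquiv (Units.mk0 _ hj) j).trans φ, hjJ,
      ((isClifford_mul _ _).trans h1).mono (by lia), ?_, fun x hx => ?_⟩
    · rw [LinearEquiv.trans_apply, mulEquiv_cst, h2]
    · rw [LinearEquiv.trans_apply]
      have : mulEquiv (Units.mk0 _ hj) j x = x := by
        ext1 <;> simp [mulEquiv_apply, hx j hjJ]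
      rw [this, h3 x hx]
  by_cases h : ∃ j, u.1 j ≠ 0
  · obtain ⟨j, hj⟩ := h
    obtain ⟨φ, h1, h2, h3, h4⟩ := hx u j hJ hj
    exact ⟨j, φ, h1, h2.mono (by lia), h3, h4⟩
  -- Without X-components, a Fourier transform at j creates one.
  · push Not at h
    obtain ⟨j, hj⟩ : ∃ j, u.2 j ≠ 0 := by
      by_contra! h'
      exact hu (by ext i <;> simp [h, h'])
    have hjJ : j ∉ J := fun h => hj (hJ j h).2
    obtain ⟨φ, h1, h2, h3, h4⟩ := hx
      (Function.update u.1 j (u.2 j), Function.update u.2 j (-u.1 j)) j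
      (fun i hi => by
        have : i ≠ j := fun e => hjJ (e ▸ hi)
        simp [this, hJ i hi]) (by simpa using hj)
    refine ⟨j, (dftEquiv j).trans φ, h1, ((isClifford_dft _).trans h2).mono (by lia), ?_,
      fun x hx => ?_⟩
    · rw [LinearEquiv.trans_apply, dftEquiv_cst, h3]
    · rw [LinearEquiv.trans_apply]
      have : dftEquiv j x = x := by
        ext1 <;> simp [dftEquiv_apply, hx j hjJ]
      rw [this, h4 x hx]

theorem sympl_pauliX_left (j : ι) (v : Pauli F ι) : sympl (pauliX j) v = v.2 j := by
  simp [sympl_apply, pauliX, Pi.single_apply]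

theorem form_pauliX (j : ι) (x : PauliRow F ι) : form x (cst (pauliX j)) = - x.2 j := by
  simp [form, cst, pauliX, Pi.single_apply, apply_ite]

theorem form_pauliZ (j : ι) (x : PauliRow F ι) : form x (cst (pauliZ j)) = x.1 j := by
  simp [form, cst, pauliZ, Pi.single_apply, apply_ite]

/-- Once u has become X_j, the pairing forces the Z-component of v at j to be 1. After a Fourier
transform at j, v can be pivoted to X_j while u, now -Z_j, stays fixed; the inverse transform
restores the roles. -/
theorem exists_clifford_hyperbolic (u v : Pauli F ι) (h : sympl u v = 1) :
    ∃ (j : ι) (φ : PauliRow F ι ≃ₗ[F[T;T⁻¹]] PauliRow F ι),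
      IsClifford (16 * Fintype.card ι + 7) φ ∧ φ (cst u) = cst (pauliX j) ∧
      φ (cst v) = cst (pauliZ j) := by
  have hu : u ≠ 0 := by rintro rfl; simp at h
  obtain ⟨j, φ, -, h1, h2, -⟩ := exists_clifford_to_pauliX ∅ u (by simp) hu
  obtain ⟨v', hv'⟩ := h1.map_cst v
  have hj : v'.2 j = 1 := by rw [← sympl_pauliX_left, h1.sympl_eq h2 hv', h]
  obtain ⟨ψ, g1, g2, g3, -⟩ := exists_clifford_pivot ∅ j (by simp)
    (Function.update v'.1 j (v'.2 j), Function.update v'.2 j (-v'.1 j)) (by simp) (by simpa using hj)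
  refine ⟨j, ((φ.trans (dftEquiv j)).trans ψ).trans (dftEquiv j).symm,
    (((h1.trans (isClifford_dft j)).trans g1).trans (isClifford_dft_symm j)).mono (by lia), ?_, ?_⟩
  · simp only [LinearEquiv.trans_apply, h2, dftEquiv_cst]
    have : cst (Function.update (pauliX (F := F) j).1 j ((pauliX j).2 j),
        Function.update (pauliX j).2 j (-(pauliX (F := F) j).1 j)) = - cst (pauliZ j) := by
      rw [← map_neg]
      congr 1
      ext m <;> by_cases e : m = j <;> simp [pauliX, pauliZ, e]
    rw [this, map_neg, map_neg, g2, dftEquiv_symm_cst, ← map_neg]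
    congr 1
    ext m <;> by_cases e : m = j <;> simp [pauliX, pauliZ, e]
  · simp only [LinearEquiv.trans_apply, hv', dftEquiv_cst, g3, dftEquiv_symm_cst]
    congr 1
    ext m <;> by_cases e : m = j <;> simp [pauliX, pauliZ, e]

theorem Implements.conj {k k' : ℕ} {φ ψ : PauliRow F ι ≃ₗ[F[T;T⁻¹]] PauliRow F ι}
    (hφ : Implements k φ) (hψ : Implements k' ψ) :
    Implements (2 * k + k') ((φ.trans ψ).trans φ.symm) :=
  ((hφ.trans hψ).trans hφ.symm).mono (by lia)

omit [DecidableEq ι] in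
theorem card_pos_of_ne_zero {u : Pauli F ι} (hu : u ≠ 0) : 0 < Fintype.card ι := by
  rw [Fintype.card_pos_iff]
  by_contra h
  rw [not_nonempty_iff] at h
  exact hu (Subsingleton.elim _ _)

/-- In coordinates where u and v are X_j and Z_j, this is the delay of qudit j: the plane of u and v
is multiplied by D^k and its orthogonal complement is fixed. The bound 60 n is shared with the two
isometries below; the largest actual cost is 2 (16 n + 9) + 7, and n ≥ 1. -/
theorem exists_implements_delay (u v : Pauli F ι) (h : sympl u v = 1) (k : ℤ) :
    ∃ φ : PauliRow F ι ≃ₗ[F[T;T⁻¹]] PauliRow F ι, Implements (60 * Fintype.card ι) φ ∧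
      ∀ x, φ x = x + ((T k - 1) * form x (cst v)) • cst u
        - ((T k - 1) * form x (cst u)) • cst v := by
  obtain ⟨j, φ, h1, h2, h3⟩ := exists_clifford_hyperbolic u v h
  have hn : 0 < Fintype.card ι := card_pos_of_ne_zero (u := u) (by rintro rfl; simp at h)
  refine ⟨_, (h1.toImplements.conj (implements_delay j k)).mono (by lia), fun x => ?_⟩
  rw [LinearEquiv.trans_apply, LinearEquiv.symm_apply_eq, LinearEquiv.trans_apply, map_sub, map_add,
    map_smul, map_smul, h2, h3, ← h1.isom x, ← h1.isom x, h2, h3, form_pauliX, form_pauliZ]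
  generalize φ x = y
  change delay j k y = _
  ext1 <;> ext1 m <;> by_cases e : m = j <;>
    simp [delay_apply, cst, pauliX, pauliZ, e, Pi.single_apply, -T_mul] <;> ring

/-- With u moved to X_j, the map adds a multiple of z_j to x_j. This is a controlled phase
conjugated by a Fourier transform. -/
theorem exists_implements_transvection [Finite F] (u : Pauli F ι) (hu : u ≠ 0) (γ : F) (m : ℤ)
    (hm : m ≠ 0) :
    ∃ φ : PauliRow F ι ≃ₗ[F[T;T⁻¹]] PauliRow F ι, Implements (60 * Fintype.card ι) φ ∧
      ∀ x, φ x = x + (LaurentPolynomial.C γ * (T m + T (-m)) * form x (cst u)) • cst u := by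
  obtain ⟨j, φ, -, h1, h2, -⟩ := exists_clifford_to_pauliX ∅ u (by simp) hu
  have hn : 0 < Fintype.card ι := card_pos_of_ne_zero hu
  refine ⟨_, (h1.toImplements.conj ((implements_dft j).conj (implements_shear j m hm γ))).mono
    (by lia), fun x => ?_⟩
  rw [LinearEquiv.trans_apply, LinearEquiv.symm_apply_eq, LinearEquiv.trans_apply, map_add,
    map_smul, h2, ← h1.isom x, h2, form_pauliX]
  generalize φ x = y
  simp only [LinearEquiv.trans_apply, dftEquiv_apply, dftEquiv_symm_apply, shear_apply]
  ext1 <;> ext1 i <;> by_cases e : i = j <;>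
    simp [cst, pauliX, e, -T_mul] <;> ring

theorem exists_clifford_isotropic (u y : Pauli F ι) (h : sympl u y = 0) (hu : u ≠ 0)
    (hy : ∀ a : F, y ≠ a • u) :
    ∃ (i j : ι) (_ : i ≠ j) (φ : PauliRow F ι ≃ₗ[F[T;T⁻¹]] PauliRow F ι),
      IsClifford (16 * Fintype.card ι + 9) φ ∧ φ (cst u) = cst (pauliX i) ∧
      φ (cst y) = cst (pauliX j) := by
  obtain ⟨i, φ, -, h1, h2, -⟩ := exists_clifford_to_pauliX ∅ u (by simp) hu
  obtain ⟨y', hy'⟩ := h1.map_cst y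
  have hi : y'.2 i = 0 := by rw [← sympl_pauliX_left, h1.sympl_eq h2 hy', h]
  have hne : y' - y'.1 i • pauliX i ≠ 0 := by
    intro e
    refine hy (y'.1 i) ?_
    have : cst y = cst (y'.1 i • u) := by
      apply φ.injective
      rw [hy', map_smul, equiv_smul, h2, ← map_smul, ← sub_eq_zero.1 e]
    simpa [coef_zero_cst] using congrArg (coef 0) this
  -- Orthogonality to X_i removes the Z-component at i. Subtracting the X-component leaves a vector
  -- off i, which can be straightened without touching X_i; the final ADD compensates for the
  -- subtraction.
  obtain ⟨j, ψ, g1, g2, g3, g4⟩ := exists_clifford_to_pauliX {i} (y' - y'.1 i • pauliX i)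
    (by simp [pauliX, hi]) hne
  have hji : j ≠ i := by simpa using g1
  have hfix : ψ (cst (pauliX i)) = cst (pauliX i) := g4 _ fun m hm => by
    have : m ≠ i := by simpa using hm
    simp [cst, pauliX, this]
  refine ⟨i, j, hji.symm, (φ.trans ψ).trans (addEquiv j i hji (LaurentPolynomial.C (-y'.1 i))),
    ((h1.trans g2).trans (isClifford_add _ _ _ _)).mono (by lia), ?_, ?_⟩
  · simp only [LinearEquiv.trans_apply, h2, hfix, addEquiv_cst]
    congr 1
    ext m <;> by_cases e : m = i <;> simp [pauliX, e, hji]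
  · have e0 : ψ (cst y') = cst (pauliX j + y'.1 i • pauliX i) := by
      have : cst y' = cst (y' - y'.1 i • pauliX i) + y'.1 i • cst (pauliX i) := by
        rw [← map_smul, ← map_add, sub_add_cancel]
      rw [this, map_add, g3, equiv_smul, hfix, map_add, map_smul]
    simp only [LinearEquiv.trans_apply, hy', e0, addEquiv_cst]
    congr 1
    ext m <;> by_cases e : m = i <;> by_cases e' : m = j <;> simp [pauliX, e, e', hji, hji.symm]

/-- With u and y moved to X_i and X_j, multiples of z_i are added to x_j and of z_j to x_i. An ADD
gate does this when its source qudit is Fourier transformed before and back after it. -/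
theorem exists_implements_siegel (u y : Pauli F ι) (h : sympl u y = 0) (hu : u ≠ 0)
    (hy : ∀ a : F, y ≠ a • u) (γ : F) (m : ℤ) :
    ∃ φ : PauliRow F ι ≃ₗ[F[T;T⁻¹]] PauliRow F ι, Implements (60 * Fintype.card ι) φ ∧
      ∀ x, φ x = x + (LaurentPolynomial.C γ * T (-m) * form x (cst y)) • cst u
        + (LaurentPolynomial.C γ * T m * form x (cst u)) • cst y := by
  obtain ⟨i, j, hij, φ, h1, h2, h3⟩ := exists_clifford_isotropic u y h hu hy
  have hn : 0 < Fintype.card ι := card_pos_of_ne_zero hu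
  refine ⟨_, (h1.toImplements.conj ((implements_dft i).conj
    (implements_add i j hij (-γ) m))).mono (by lia), fun x => ?_⟩
  rw [LinearEquiv.trans_apply, LinearEquiv.symm_apply_eq, LinearEquiv.trans_apply, map_add, map_add,
    map_smul, map_smul, h2, h3, ← h1.isom x, ← h1.isom x, h2, h3, form_pauliX, form_pauliX]
  generalize φ x = w
  simp only [LinearEquiv.trans_apply, dftEquiv_apply, dftEquiv_symm_apply, addEquiv_apply]
  ext1 <;> ext1 k <;> by_cases e : k = i <;> by_cases e' : k = j <;>
    first
    | exact absurd (e.symm.trans e') hij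
    | simp [cst, pauliX, e, e', hij, hij.symm, -T_mul, -mul_T_assoc]
  all_goals ring

end Clifford

/-! ### Polynomials among Laurent polynomials. -/

theorem coeff_toLaurent_natCast {F : Type*} [Field F] (p : F[X]) (n : ℕ) :
    (toLaurent p).coeff (n : ℤ) = p.coeff n := by
  rw [coeff_toLaurent]
  exact Finsupp.mapDomain_apply Nat.cast_injective _ _

theorem coeff_toLaurent_of_neg {F : Type*} [Field F] (p : F[X]) {k : ℤ} (hk : k < 0) :
    (toLaurent p).coeff k = 0 := by
  rw [coeff_toLaurent]
  refine Finsupp.mapDomain_of_notMem_range _ _ ?_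
  rintro ⟨n, rfl⟩
  simp at hk; lia

theorem exists_toLaurent_eq {F : Type*} [Field F] (f : F[T;T⁻¹])
    (hf : ∀ k, k < 0 → f.coeff k = 0) : ∃ p : F[X], toLaurent p = f := by
  obtain ⟨n, g, hg⟩ := exists_T_pow f
  have : X ^ n ∣ g := by
    rw [X_pow_dvd_iff]
    intro d hd
    rw [← coeff_toLaurent_natCast, hg, mul_comm, coeff_T_mul]
    exact hf _ (by lia)
  obtain ⟨p, rfl⟩ := this
  refine ⟨p, ?_⟩
  rw [map_mul, toLaurent_X_pow, mul_comm] at hg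
  exact (isUnit_T (R := F) n).mul_right_cancel hg

/-! ### The degree of a module of rows and its fibres at D = 0 and D = ∞. -/

section Degree

variable {F ι : Type*} [Field F]

/-- Rows without negative powers of `D`. -/
def posPart (F ι : Type*) [Field F] : Submodule F (PauliRow F ι) where
  carrier := {x | ∀ k, k < 0 → coef k x = 0}
  zero_mem' k _ := map_zero _
  add_mem' hx hy k hk := by rw [map_add, hx k hk, hy k hk, add_zero]
  smul_mem' a x hx k hk := by rw [map_smul, hx k hk, smul_zero]

/-- Rows with only negative powers of `D`. -/
def negPart (F ι : Type*) [Field F] : Submodule F (PauliRow F ι) where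
  carrier := {x | ∀ k, 0 ≤ k → coef k x = 0}
  zero_mem' k _ := map_zero _
  add_mem' hx hy k hk := by rw [map_add, hx k hk, hy k hk, add_zero]
  smul_mem' a x hx k hk := by rw [map_smul, hx k hk, smul_zero]

theorem eq_zero_of_mem_posPart_of_mem_negPart {x : PauliRow F ι} (h : x ∈ posPart F ι)
    (h' : x ∈ negPart F ι) : x = 0 :=
  ext_coef fun k => by
    rw [map_zero]
    rcases lt_or_ge k 0 with hk | hk
    · exact h k hk
    · exact h' k hk

/-- The rows in `M` that are the sum of a row in `M` without negative powers of `D` and a row in `M`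
with only negative powers. -/
noncomputable def splitPart (M : Submodule F[T;T⁻¹] (PauliRow F ι)) : Submodule F M :=
  (posPart F ι).comap (M.subtype.restrictScalars F) ⊔
    (negPart F ι).comap (M.subtype.restrictScalars F)

/-- The degree of the module `M` is at most `N`. -/
def DegreeLE (N : ℕ) (M : Submodule F[T;T⁻¹] (PauliRow F ι)) : Prop :=
  Module.Finite F (M ⧸ splitPart M) ∧ Module.finrank F (M ⧸ splitPart M) ≤ N

theorem finrank_quotient_lt {K E : Type*} [Field K] [AddCommGroup E] [Module K E]
    {A B : Submodule K E} (hAB : A < B) (hA : Module.Finite K (E ⧸ A)) :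
    Module.Finite K (E ⧸ B) ∧ Module.finrank K (E ⧸ B) < Module.finrank K (E ⧸ A) := by
  obtain ⟨p, hpB, hpA⟩ := SetLike.exists_of_lt hAB
  have hs : Function.Surjective (Submodule.factor hAB.le) := Submodule.factor_surjective hAB.le
  refine ⟨Module.Finite.of_surjective _ hs, ?_⟩
  have h1 := (Submodule.factor hAB.le).finrank_range_add_finrank_ker
  rw [LinearMap.range_eq_top.2 hs, finrank_top] at h1
  have h2 : 0 < Module.finrank K (LinearMap.ker (Submodule.factor hAB.le)) := by
    rw [Module.finrank_pos_iff_exists_ne_zero]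
    refine ⟨⟨Submodule.Quotient.mk p, ?_⟩, fun h => hpA ?_⟩
    · rw [LinearMap.mem_ker]
      exact (Submodule.Quotient.mk_eq_zero B).2 hpB
    · exact (Submodule.Quotient.mk_eq_zero A).1 (congrArg Subtype.val h)
  lia

/-- The split part can only grow under φ, and p makes it grow. If p = a + b were already split and φ
p positive, then φ b would be both positive and negative, so b = 0 and p = a would be positive from
the start; the negative case is symmetric. -/
theorem DegreeLE.map {N : ℕ} {M : Submodule F[T;T⁻¹] (PauliRow F ι)} (h : DegreeLE N M)
    (φ : PauliRow F ι ≃ₗ[F[T;T⁻¹]] PauliRow F ι)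
    (hP : ∀ x ∈ M, x ∈ posPart F ι → φ x ∈ posPart F ι)
    (hQ : ∀ x ∈ M, x ∈ negPart F ι → φ x ∈ negPart F ι)
    (hp : ∃ p ∈ M, (φ p ∈ posPart F ι ∧ p ∉ posPart F ι) ∨ (φ p ∈ negPart F ι ∧ p ∉ negPart F ι)) :
    0 < N ∧ DegreeLE (N - 1) (M.map φ.toLinearMap) := by
  let e : M ≃ₗ[F] M.map φ.toLinearMap := (φ.submoduleMap M).restrictScalars F
  have he : ∀ x : M, ((e x : M.map φ.toLinearMap) : PauliRow F ι) = φ x := fun x => rfl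
  have hle : splitPart M ≤ (splitPart (M.map φ.toLinearMap)).comap e.toLinearMap := by
    refine sup_le (fun x hx => ?_) (fun x hx => ?_)
    · exact Submodule.mem_sup_left (hP x x.2 hx)
    · exact Submodule.mem_sup_right (hQ x x.2 hx)
  have hlt : splitPart M < (splitPart (M.map φ.toLinearMap)).comap e.toLinearMap := by
    refine lt_of_le_of_ne hle fun heq => ?_
    obtain ⟨p, hpM, hp⟩ := hp
    have hmem : (⟨p, hpM⟩ : M) ∈ splitPart M := by
      rw [heq]
      rcases hp with hp | hp
      · exact Submodule.mem_sup_left (show φ p ∈ posPart F ι from hp.1)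
      · exact Submodule.mem_sup_right (show φ p ∈ negPart F ι from hp.1)
    obtain ⟨a, ha, b, hb, hab⟩ := Submodule.mem_sup.1 hmem
    have hab' : (a : PauliRow F ι) + b = p := congrArg Subtype.val hab
    have ha1 : (a : PauliRow F ι) ∈ posPart F ι := ha
    have hb1 : (b : PauliRow F ι) ∈ negPart F ι := hb
    have ha2 := hP a a.2 ha1
    have hb2 := hQ b b.2 hb1
    have hsum : φ p = φ a + φ b := by rw [← hab', map_add]
    rcases hp with hp | hp
    · have : φ b ∈ posPart F ι := by
        rw [show φ b = φ p - φ a by rw [hsum]; abel]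
        exact sub_mem hp.1 ha2
      have : φ b = 0 := eq_zero_of_mem_posPart_of_mem_negPart this hb2
      rw [LinearEquiv.map_eq_zero_iff] at this
      rw [this, add_zero] at hab'
      exact hp.2 (hab' ▸ ha1)
    · have : φ a ∈ negPart F ι := by
        rw [show φ a = φ p - φ b by rw [hsum]; abel]
        exact sub_mem hp.1 hb2
      have : φ a = 0 := eq_zero_of_mem_posPart_of_mem_negPart ha2 this
      rw [LinearEquiv.map_eq_zero_iff] at this
      rw [this, zero_add] at hab'
      exact hp.2 (hab' ▸ hb1)
  obtain ⟨h1, h2⟩ := finrank_quotient_lt hlt h.1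
  let q := Submodule.Quotient.equiv _ (splitPart (M.map φ.toLinearMap)) e
    (Submodule.map_comap_eq_of_surjective e.surjective _)
  have h3 := h.2
  refine ⟨by lia, Module.Finite.equiv q, ?_⟩
  rw [← q.finrank_eq]
  lia

/-- The constant coefficients of the rows in `M` without negative powers of `D`. -/
noncomputable def lowSpace (M : Submodule F[T;T⁻¹] (PauliRow F ι)) : Submodule F (Pauli F ι) :=
  (M.restrictScalars F ⊓ posPart F ι).map (coef 0)

/-- The constant coefficients of the rows in `M` without positive powers of `D`. -/
def highSpace (M : Submodule F[T;T⁻¹] (PauliRow F ι)) : Submodule F (Pauli F ι) where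
  carrier := {u | ∃ x ∈ M, (∀ k, 0 < k → coef k x = 0) ∧ coef 0 x = u}
  zero_mem' := ⟨0, M.zero_mem, fun _ _ => map_zero _, map_zero _⟩
  add_mem' := by
    rintro _ _ ⟨x, hx, hx', rfl⟩ ⟨y, hy, hy', rfl⟩
    exact ⟨x + y, M.add_mem hx hy, fun k hk => by rw [map_add, hx' k hk, hy' k hk, add_zero],
      map_add _ _ _⟩
  smul_mem' := by
    rintro a _ ⟨x, hx, hx', rfl⟩
    exact ⟨a • x, (M.restrictScalars F).smul_mem a hx,
      fun k hk => by rw [map_smul, hx' k hk, smul_zero], map_smul _ _ _⟩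

variable {M : Submodule F[T;T⁻¹] (PauliRow F ι)}

theorem mem_lowSpace {u : Pauli F ι} :
    u ∈ lowSpace M ↔ ∃ x ∈ M, x ∈ posPart F ι ∧ coef 0 x = u := by
  constructor
  · rintro ⟨x, ⟨h1, h2⟩, h3⟩
    exact ⟨x, h1, h2, h3⟩
  · rintro ⟨x, h1, h2, h3⟩
    exact ⟨x, ⟨h1, h2⟩, h3⟩

theorem coef_mem_highSpace {x : PauliRow F ι} (hx : x ∈ M) {n : ℤ}
    (h : ∀ k, n < k → coef k x = 0) : coef n x ∈ highSpace M :=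
  ⟨(T (-n) : F[T;T⁻¹]) • x, M.smul_mem _ hx,
    fun k hk => by rw [coef_T_smul]; exact h _ (by lia), by rw [coef_T_smul, zero_sub, neg_neg]⟩

theorem coef_mem_lowSpace {x : PauliRow F ι} (hx : x ∈ M) {n : ℤ}
    (h : ∀ k, k < n → coef k x = 0) : coef n x ∈ lowSpace M :=
  mem_lowSpace.2 ⟨(T (-n) : F[T;T⁻¹]) • x, M.smul_mem _ hx,
    fun k hk => by rw [coef_T_smul]; exact h _ (by lia), by rw [coef_T_smul, zero_sub, neg_neg]⟩

variable [Fintype ι]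

/-- Write t = u + D^m t' with u constant and t' free of negative powers. In the vanishing form of x
and t, the part from t' has only powers up to -m, so above -m the coefficients of x are orthogonal
to u. For m = 1 this makes the two fibres orthogonal. -/
theorem sympl_coef_eq_zero (hM : ∀ x ∈ M, ∀ y ∈ M, form x y = 0) {x t : PauliRow F ι}
    (hx : x ∈ M) (ht : t ∈ M) (hx' : ∀ k, 0 < k → coef k x = 0) (ht' : t ∈ posPart F ι)
    {m : ℤ} (hm : ∀ k, 0 < k → k < m → coef k t = 0) {k : ℤ} (hk : -m < k) :
    sympl (coef k x) (coef 0 t) = 0 := by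
  set t' : PauliRow F ι := (T (-m) : F[T;T⁻¹]) • (t - cst (coef 0 t)) with ht'_def
  have e : t = cst (coef 0 t) + (T m : F[T;T⁻¹]) • t' := by
    rw [ht'_def, smul_smul, ← T_add, add_neg_cancel, T_zero, one_smul, add_sub_cancel]
  have hpos : ∀ k, k < 0 → coef k t' = 0 := by
    intro k hk
    rw [ht'_def, coef_T_smul, map_sub, coef_cst]
    split_ifs with h0
    · rw [h0, sub_self]
    · rw [sub_zero]
      rcases lt_or_ge (k - -m) 0 with h1 | h1
      · exact ht' _ h1
      · exact hm _ (by lia) (by lia)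
  have h := hM x hx t ht
  rw [e, form_add_right, form_smul_right, invert_T] at h
  have h2 := congrArg (fun f => f.coeff k) h
  simp only [AddMonoidAlgebra.coeff_add, Finsupp.add_apply, coeff_form_cst, coeff_T_mul] at h2
  rw [coeff_form_eq_zero hx' hpos (by lia)] at h2
  simpa using h2

theorem sympl_highSpace_lowSpace (hM : ∀ x ∈ M, ∀ y ∈ M, form x y = 0) {u w : Pauli F ι}
    (hu : u ∈ highSpace M) (hw : w ∈ lowSpace M) : sympl u w = 0 := by
  obtain ⟨x, hx, hx', rfl⟩ := hu
  obtain ⟨t, ht, ht', rfl⟩ := mem_lowSpace.1 hw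
  exact sympl_coef_eq_zero hM hx ht hx' ht' (m := 1) (fun k h1 h2 => by lia) (by lia)

/-- L is its own double orthogonal complement, so some vector orthogonal to L detects u. -/
theorem exists_dual (L : Submodule F (Pauli F ι)) {u : Pauli F ι} (hu : u ∉ L) :
    ∃ y, (∀ l ∈ L, sympl l y = 0) ∧ sympl u y = 1 := by
  rw [← LinearMap.BilinForm.orthogonal_orthogonal sympl_nondegenerate sympl_isRefl L,
    LinearMap.BilinForm.mem_orthogonal_iff] at hu
  push Not at hu
  obtain ⟨y, hy, hyu⟩ := hu
  rw [LinearMap.BilinForm.mem_orthogonal_iff] at hy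
  have hyu' : sympl u y ≠ 0 := fun h => hyu (sympl_isRefl _ _ h)
  refine ⟨(sympl u y)⁻¹ • y, fun l hl => ?_, ?_⟩
  · rw [map_smul, show sympl l y = 0 from hy l hl, smul_zero]
  · rw [map_smul, smul_eq_mul, inv_mul_cancel₀ hyu']

theorem exists_T_smul_mem_posPart (x : PauliRow F ι) :
    ∃ n : ℕ, (T n : F[T;T⁻¹]) • x ∈ posPart F ι := by
  have h : ∀ f : F[T;T⁻¹], ∃ n : ℕ, ∀ k : ℤ, k < -n → f.coeff k = 0 := by
    intro f
    obtain ⟨n, g, hg⟩ := exists_T_pow f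
    refine ⟨n, fun k hk => ?_⟩
    have := coeff_toLaurent_of_neg g (k := k + n) (by lia)
    rw [hg, mul_comm, coeff_T_mul] at this
    simpa using this
  choose n hn using h
  refine ⟨∑ i, (n (x.1 i) + n (x.2 i)), fun k hk => ?_⟩
  have hle : ∀ i, n (x.1 i) + n (x.2 i) ≤ ∑ i, (n (x.1 i) + n (x.2 i)) := fun i =>
    Finset.single_le_sum (f := fun i => n (x.1 i) + n (x.2 i)) (fun _ _ => Nat.zero_le _)
      (Finset.mem_univ i)
  rw [coef_T_smul]
  ext i
  · exact hn _ _ (by have := hle i; lia)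
  · exact hn _ _ (by have := hle i; lia)

/-- An isometry of small cost that lowers the degree of `M`. -/
def LowersDegree [DecidableEq ι] (M : Submodule F[T;T⁻¹] (PauliRow F ι)) : Prop :=
  ∃ φ : PauliRow F ι ≃ₗ[F[T;T⁻¹]] PauliRow F ι, Implements (60 * Fintype.card ι) φ ∧
    (∀ x ∈ M, x ∈ posPart F ι → φ x ∈ posPart F ι) ∧
    (∀ x ∈ M, x ∈ negPart F ι → φ x ∈ negPart F ι) ∧
    ∃ p ∈ M, (φ p ∈ posPart F ι ∧ p ∉ posPart F ι) ∨ (φ p ∈ negPart F ι ∧ p ∉ negPart F ι)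

/-! ### The isometries that lower the degree. -/

section Gain

variable [DecidableEq ι]

omit [DecidableEq ι] in
theorem coef_delay {u v : Pauli F ι} {n : ℤ} (x : PauliRow F ι) (k : ℤ) :
    coef k (x + ((T n - 1) * form x (cst v)) • cst u - ((T n - 1) * form x (cst u)) • cst v) =
      coef k x + (sympl (coef (k - n) x) v - sympl (coef k x) v) • u
        - (sympl (coef (k - n) x) u - sympl (coef k x) u) • v := by
  rw [map_sub, map_add, coef_smul_cst, coef_smul_cst]
  simp only [sub_mul, one_mul, AddMonoidAlgebra.coeff_sub, Finsupp.sub_apply, coeff_T_mul,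
    coeff_form_cst]

/-- Delay the pair (u, v) by one frame, with v orthogonal to the fibre at infinity. -/
theorem lowersDegree_of_notMem_highSpace (hM : ∀ x ∈ M, ∀ y ∈ M, form x y = 0) {u : Pauli F ι}
    (hu : u ∈ lowSpace M) (hu' : u ∉ highSpace M) : LowersDegree M := by
  obtain ⟨v, hv, huv⟩ := exists_dual _ hu'
  obtain ⟨φ, h1, h2⟩ := exists_implements_delay u v huv 1
  refine ⟨φ, h1, fun x hx hxP k hk => ?_, fun x hx hxQ k hk => ?_, ?_⟩
  · rw [h2, coef_delay, hxP k hk, hxP (k - 1) (by lia)]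
    simp
  · rw [h2, coef_delay, hxQ k hk]
    -- Only k = 0 is critical: the top coefficient could move into degree 0, but it is orthogonal to
    -- v by choice and to u by isotropy.
    have hmem : coef (k - 1) x ∈ highSpace M := coef_mem_highSpace hx fun j hj => hxQ j (by lia)
    rw [hv _ hmem, sympl_highSpace_lowSpace hM hmem hu]
    simp
  · obtain ⟨t, ht, htP, ht0⟩ := mem_lowSpace.1 hu
    -- This row begins with u in degree -1, which the delay moves to degree 0.
    refine ⟨(T (-1) : F[T;T⁻¹]) • t, M.smul_mem _ ht, Or.inl ⟨fun k hk => ?_, fun h => ?_⟩⟩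
    · rw [h2, coef_delay, coef_T_smul, coef_T_smul, htP (k - 1 - -1) (by lia)]
      rcases eq_or_ne k (-1) with rfl | hk'
      · simp [ht0, huv, sympl_self]
      · rw [htP (k - -1) (by lia)]; simp
    · have := h (-1) (by lia)
      rw [coef_T_smul, sub_self, ht0] at this
      rw [this] at hu'
      exact hu' (zero_mem _)

/-- The mirror image under exchange of 0 and ∞, with an advance by one frame: a row ending with u in
degree 0 becomes negative. -/
theorem lowersDegree_of_notMem_lowSpace (hM : ∀ x ∈ M, ∀ y ∈ M, form x y = 0) {u : Pauli F ι}
    (hu : u ∈ highSpace M) (hu' : u ∉ lowSpace M) : LowersDegree M := by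
  obtain ⟨v, hv, huv⟩ := exists_dual _ hu'
  obtain ⟨φ, h1, h2⟩ := exists_implements_delay u v huv (-1)
  refine ⟨φ, h1, fun x hx hxP k hk => ?_, fun x hx hxQ k hk => ?_, ?_⟩
  · rw [h2, coef_delay, hxP k hk]
    have hmem : coef (k - -1) x ∈ lowSpace M := coef_mem_lowSpace hx fun j hj => hxP j (by lia)
    rw [hv _ hmem, sympl_swap _ u, sympl_highSpace_lowSpace hM hu hmem]
    simp
  · rw [h2, coef_delay, hxQ k hk, hxQ (k - -1) (by lia)]
    simp
  · obtain ⟨t, ht, htQ, ht0⟩ := hu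
    refine ⟨t, ht, Or.inr ⟨fun k hk => ?_, fun h => ?_⟩⟩
    · rw [h2, coef_delay, htQ (k - -1) (by lia)]
      rcases eq_or_ne k 0 with rfl | hk'
      · simp [ht0, huv, sympl_self]
      · rw [htQ k (by lia)]; simp
    · have := h 0 le_rfl
      rw [ht0] at this
      rw [this] at hu'
      exact hu' (zero_mem _)

/-- Let m be the first degree in which a positive row leaves the common fibre L, and normalise such
a row to t = u + D^m w + .... An isometry that uses w to cancel u makes D⁻¹ t positive, and the
minimality of m protects all other positive rows. -/
theorem lowersDegree_of_coef_notMem [Finite F] (hM : ∀ x ∈ M, ∀ y ∈ M, form x y = 0)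
    (hL : lowSpace M = highSpace M) (h : ∃ m : ℕ, ∃ t ∈ M, t ∈ posPart F ι ∧
      coef (m : ℤ) t ∉ lowSpace M) : LowersDegree M := by
  classical
  obtain ⟨m, hex, hmin⟩ : ∃ m : ℕ, (∃ t ∈ M, t ∈ posPart F ι ∧ coef (m : ℤ) t ∉ lowSpace M) ∧
      ∀ j : ℕ, j < m → ∀ t ∈ M, t ∈ posPart F ι → coef (j : ℤ) t ∈ lowSpace M :=
    ⟨Nat.find h, Nat.find_spec h, fun j hj t ht htP => by
      by_contra hc
      exact Nat.find_min h hj ⟨t, ht, htP, hc⟩⟩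
  have hlow : ∀ t ∈ M, t ∈ posPart F ι → ∀ k : ℤ, k < m → coef k t ∈ lowSpace M := by
    intro t ht htP k hk
    rcases lt_or_ge k 0 with h0 | h0
    · rw [htP k h0]; exact zero_mem _
    · lift k to ℕ using h0
      exact hmin k (by lia) t ht htP
  -- The coefficients in degrees 1 to m - 1 lie in L and are removed one at a time by shifted lifts
  -- from M. This alters the coefficient in degree m only by elements of L.
  have hnorm : ∀ j : ℕ, j + 1 ≤ m → ∃ t ∈ M, t ∈ posPart F ι ∧ coef (m : ℤ) t ∉ lowSpace M ∧
      ∀ k : ℤ, 0 < k → k < j + 1 → coef k t = 0 := by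
    intro j
    induction j with
    | zero =>
      intro _
      obtain ⟨t, ht, htP, htm⟩ := hex
      exact ⟨t, ht, htP, htm, fun k h1 h2 => by simp at h2; lia⟩
    | succ j ih =>
      intro hj
      obtain ⟨t, ht, htP, htm, htk⟩ := ih (by lia)
      obtain ⟨s, hs, hsP, hs0⟩ := mem_lowSpace.1 (hlow t ht htP (j + 1) (by lia))
      refine ⟨t - (T (j + 1) : F[T;T⁻¹]) • s, M.sub_mem ht (M.smul_mem _ hs), ?_, ?_, ?_⟩
      · intro k hk
        rw [map_sub, coef_T_smul, htP k hk, hsP _ (by lia), sub_zero]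
      · rw [map_sub, coef_T_smul]
        intro hc
        exact htm (((lowSpace M).sub_mem_iff_left (hlow s hs hsP _ (by lia))).1 hc)
      · intro k h1 h2
        rw [map_sub, coef_T_smul]
        rcases eq_or_ne k (j + 1) with rfl | hk
        · rw [sub_self, hs0, sub_self]
        · rw [htk k h1 (by push_cast at h2; lia), hsP _ (by push_cast at h2; lia), sub_zero]
  have hm0 : m ≠ 0 := by
    rintro rfl
    obtain ⟨t, ht, htP, htm⟩ := hex
    exact htm (mem_lowSpace.2 ⟨t, ht, htP, rfl⟩)
  obtain ⟨t, ht, htP, htm, htk⟩ := hnorm (m - 1) (by lia)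
  have htk' : ∀ k : ℤ, 0 < k → k < m → coef k t = 0 := fun k h1 h2 => htk k h1 (by lia)
  set u := coef 0 t with hu
  have huL : u ∈ lowSpace M := mem_lowSpace.2 ⟨t, ht, htP, rfl⟩
  have hu0 : u ≠ 0 := by
    intro h0
    refine htm (coef_mem_lowSpace ht fun k hk => ?_)
    rcases lt_trichotomy k 0 with h1 | rfl | h1
    · exact htP k h1
    · exact h0
    · exact htk' k h1 hk
  have hxu : ∀ x ∈ M, x ∈ posPart F ι → ∀ k : ℤ, k < m → sympl (coef k x) u = 0 :=
    fun x hx hxP k hk => sympl_highSpace_lowSpace hM (hL ▸ hlow x hx hxP k hk) huL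
  -- Multiplying x by D still leaves no positive powers and gains the boundary case k = -m.
  have hxu' : ∀ x ∈ M, x ∈ negPart F ι → ∀ k : ℤ, -m ≤ k → sympl (coef k x) u = 0 := by
    intro x hx hxQ k hk
    have := sympl_coef_eq_zero hM (M.smul_mem (T 1) hx) ht
      (fun k hk => by rw [coef_T_smul]; exact hxQ _ (by lia)) htP htk' (k := k + 1) (by lia)
    rwa [coef_T_smul, add_sub_cancel_right] at this
  have hpnot : (T (-1) : F[T;T⁻¹]) • t ∉ posPart F ι := fun h => by
    have := h (-1) (by lia)
    rw [coef_T_smul, sub_self] at this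
    exact hu0 this
  -- If w is orthogonal to u, no transvection along u can cancel u; a second direction y, orthogonal
  -- to L and dual to w, is needed. It is not a multiple of u, as w distinguishes them.
  by_cases hw : sympl (coef (m : ℤ) t) u = 0
  · obtain ⟨y, hy, hwy⟩ := exists_dual _ htm
    obtain ⟨φ, h1, h2⟩ := exists_implements_siegel u y (hy u huL) hu0
      (fun a e => by rw [e, map_smul, hw, smul_zero] at hwy; exact zero_ne_one hwy) (-1) m
    have h3 : ∀ x k, coef k (φ x) = coef k x - sympl (coef (k + m) x) y • u
        - sympl (coef (k - m) x) u • y := by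
      intro x k
      rw [h2, map_add, map_add, coef_smul_cst, coef_smul_cst, mul_assoc, mul_assoc, coeff_C_mul,
        coeff_C_mul, coeff_T_mul, coeff_T_mul, coeff_form_cst, coeff_form_cst, sub_neg_eq_add]
      module
    refine ⟨φ, h1, fun x hx hxP k hk => ?_, fun x hx hxQ k hk => ?_,
      (T (-1) : F[T;T⁻¹]) • t, M.smul_mem _ ht, Or.inl ⟨fun k hk => ?_, hpnot⟩⟩
    · rw [h3, hxP k hk, hxP (k - m) (by lia), hy _ (hlow x hx hxP _ (by lia))]
      simp
    · rw [h3, hxQ k hk, hxQ (k + m) (by lia), hxu' x hx hxQ _ (by lia)]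
      simp
    · rw [map_smul, coef_T_smul, h3, hxu t ht htP _ (by lia)]
      rcases eq_or_ne k (-1) with rfl | hk'
      · simp [hwy, ← hu]
      · rw [htP _ (by lia), hy _ (hlow t ht htP _ (by lia))]; simp
  -- The scalar is chosen so that the contribution of w to the constant coefficient is exactly -u.
  · obtain ⟨φ, h1, h2⟩ := exists_implements_transvection u hu0 (-(sympl (coef (m : ℤ) t) u)⁻¹) m
      (by exact_mod_cast hm0)
    have h3 : ∀ x k, coef k (φ x) = coef k x - ((sympl (coef (m : ℤ) t) u)⁻¹ *
        (sympl (coef (k - m) x) u + sympl (coef (k + m) x) u)) • u := by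
      intro x k
      rw [h2, map_add, coef_smul_cst, mul_assoc, coeff_C_mul, add_mul, AddMonoidAlgebra.coeff_add,
        Finsupp.add_apply, coeff_T_mul, coeff_T_mul, coeff_form_cst, coeff_form_cst,
        sub_neg_eq_add]
      module
    refine ⟨φ, h1, fun x hx hxP k hk => ?_, fun x hx hxQ k hk => ?_,
      (T (-1) : F[T;T⁻¹]) • t, M.smul_mem _ ht, Or.inl ⟨fun k hk => ?_, hpnot⟩⟩
    · rw [h3, hxP k hk, hxP (k - m) (by lia), hxu x hx hxP _ (by lia)]
      simp
    · rw [h3, hxQ k hk, hxQ (k + m) (by lia), hxu' x hx hxQ _ (by lia)]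
      simp
    · rw [map_smul, coef_T_smul, h3, hxu t ht htP (k - -1 - m) (by lia)]
      rcases eq_or_ne k (-1) with rfl | hk'
      · simp [hw, ← hu]
      · rw [htP (k - -1) (by lia), hxu t ht htP (k - -1 + m) (by lia)]; simp

end Gain

/-- All coefficients lie in the fibre at 0, so rows of M are Laurent combinations of a basis b of
that fibre. Lifts of b to M have a coefficient matrix A with A(0) = 1; hence det A ≠ 0, the adjugate
puts det A • b into M, and saturation removes the determinant. -/
theorem le_span_cst (hsat : ∀ (f : F[T;T⁻¹]) (x : PauliRow F ι), f ≠ 0 → f • x ∈ M → x ∈ M)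
    (h : ∀ t ∈ M, t ∈ posPart F ι → ∀ m : ℕ, coef (m : ℤ) t ∈ lowSpace M) :
    M ≤ Submodule.span F[T;T⁻¹] (cst '' {u | cst u ∈ M}) := by
  classical
  have hall : ∀ x ∈ M, ∀ k, coef k x ∈ lowSpace M := by
    intro x hx k
    obtain ⟨n, hn⟩ := exists_T_smul_mem_posPart x
    have e : coef k x = coef (k + n) ((T n : F[T;T⁻¹]) • x) := by
      rw [coef_T_smul, add_sub_cancel_right]
    rw [e]
    rcases lt_or_ge (k + n) 0 with h0 | h0
    · rw [hn _ h0]; exact zero_mem _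
    · obtain ⟨j, hj⟩ := Int.eq_ofNat_of_zero_le h0
      rw [hj]
      exact h _ (M.smul_mem _ hx) hn j
  let b := Module.finBasis F (lowSpace M)
  have hbind : LinearIndependent F (fun i => (b i : Pauli F ι)) :=
    b.linearIndependent.map' (lowSpace M).subtype (Submodule.ker_subtype _)
  have hdual : ∀ j, ∃ y, ∀ i, sympl (b i : Pauli F ι) y = if i = j then 1 else 0 := by
    intro j
    obtain ⟨y, hy, hy'⟩ := exists_dual _ (hbind.notMem_span_image (s := {j}ᶜ) (x := j) (by simp))
    refine ⟨y, fun i => ?_⟩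
    split_ifs with hij
    · rw [hij, hy']
    · exact hy _ (Submodule.subset_span ⟨i, by simpa using hij, rfl⟩)
  choose y hy using hdual
  -- Pairing with the dual vectors reads off the coordinates in all degrees at once.
  have hexp : ∀ x ∈ M, x = ∑ j, form x (cst (y j)) • cst (b j : Pauli F ι) := by
    intro x hx
    refine ext_coef fun k => ?_
    simp only [map_sum, coef_smul_cst, coeff_form_cst]
    have hk := congrArg Subtype.val (b.sum_repr ⟨coef k x, hall x hx k⟩)
    simp only [Submodule.coe_sum, Submodule.coe_smul] at hk
    have hk2 : ∀ j, sympl (coef k x) (y j) = b.repr ⟨coef k x, hall x hx k⟩ j := by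
      intro j
      conv_lhs => rw [← hk]
      simp [hy]
    simp only [hk2, hk]
  have hlift : ∀ i, ∃ x ∈ M, x ∈ posPart F ι ∧ coef 0 x = b i := fun i => mem_lowSpace.1 (b i).2
  choose x hxM hxP hx0 using hlift
  have hpol : ∀ i j, ∃ p : F[X], toLaurent p = form (x i) (cst (y j)) := fun i j =>
    exists_toLaurent_eq _ fun k hk => by rw [coeff_form_cst, hxP i k hk]; simp
  choose p hp using hpol
  let A : Matrix _ _ F[X] := Matrix.of p
  have hA0 : A.map (Polynomial.evalRingHom 0) = 1 := by
    ext i j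
    have : (p i j).coeff 0 = if i = j then 1 else 0 := by
      have := coeff_toLaurent_natCast (p i j) 0
      rw [← this, hp, Nat.cast_zero, coeff_form_cst, hx0, hy]
    simp [A, Matrix.one_apply, ← Polynomial.coeff_zero_eq_eval_zero, this]
  have hdet : A.det ≠ 0 := by
    intro h0
    have := RingHom.map_det (Polynomial.evalRingHom (0 : F)) A
    rw [h0, map_zero, RingHom.mapMatrix_apply, hA0, Matrix.det_one] at this
    exact zero_ne_one this
  have hbM : ∀ j, cst (b j : Pauli F ι) ∈ M := by
    intro j
    refine hsat (toLaurent A.det) _ (by rwa [ne_eq, toLaurent_eq_zero]) ?_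
    have : toLaurent A.det • cst (b j : Pauli F ι) =
        ∑ i, toLaurent (A.adjugate j i) • x i := by
      have e1 : ∀ i, toLaurent (A.adjugate j i) • x i =
          ∑ k, toLaurent (A.adjugate j i * A i k) • cst (b k : Pauli F ι) := by
        intro i
        conv_lhs => rw [hexp _ (hxM i), Finset.smul_sum]
        refine Finset.sum_congr rfl fun k _ => ?_
        rw [smul_smul, map_mul, ← hp]; rfl
      simp only [e1]
      rw [Finset.sum_comm]
      simp only [← Finset.sum_smul, ← map_sum, ← Matrix.mul_apply, Matrix.adjugate_mul]
      simp [Matrix.one_apply, apply_ite, ite_smul]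
    rw [this]
    exact Submodule.sum_mem _ fun i _ => M.smul_mem _ (hxM i)
  intro z hz
  rw [hexp z hz]
  exact Submodule.sum_mem _ fun j _ => Submodule.smul_mem _ _ (Submodule.subset_span ⟨_, hbM j, rfl⟩)

theorem lowersDegree_or_le_span_cst [DecidableEq ι] [Finite F]
    (hM : ∀ x ∈ M, ∀ y ∈ M, form x y = 0)
    (hsat : ∀ (f : F[T;T⁻¹]) (x : PauliRow F ι), f ≠ 0 → f • x ∈ M → x ∈ M) :
    LowersDegree M ∨ M ≤ Submodule.span F[T;T⁻¹] (cst '' {u | cst u ∈ M}) := by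
  by_cases h1 : lowSpace M ≤ highSpace M
  · by_cases h2 : highSpace M ≤ lowSpace M
    · by_cases h3 : ∃ m : ℕ, ∃ t ∈ M, t ∈ posPart F ι ∧ coef (m : ℤ) t ∉ lowSpace M
      · exact Or.inl (lowersDegree_of_coef_notMem hM (le_antisymm h1 h2) h3)
      · push Not at h3
        exact Or.inr (le_span_cst hsat fun t ht htP m => h3 m t ht htP)
    · obtain ⟨u, hu, hu'⟩ := SetLike.not_le_iff_exists.1 h2
      exact Or.inl (lowersDegree_of_notMem_lowSpace hM hu hu')
  · obtain ⟨u, hu, hu'⟩ := SetLike.not_le_iff_exists.1 h1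
    exact Or.inl (lowersDegree_of_notMem_highSpace hM hu hu')

end Degree

/-! ### Encoding of isotropic saturated modules. -/

section Encoding

variable {F ι : Type*} [Field F] [DecidableEq ι]

theorem row_trivialX {r : ℕ} (a : Fin r ↪ ι) (i : Fin r) :
    (Stabilizer.trivialX (F := F) a).row i = cst (pauliX (a i)) := by
  ext1 <;> ext1 j <;> by_cases h : j = a i <;>
    simp [Stabilizer.row, Stabilizer.trivialX, cst, pauliX, h]

theorem linearIndependent_row_trivialX {r : ℕ} (a : Fin r ↪ ι) :
    LinearIndependent F[T;T⁻¹] (Stabilizer.trivialX (F := F) a).row := by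
  rw [Fintype.linearIndependent_iff]
  intro g hg i
  have := congrFun (congrArg Prod.fst hg) (a i)
  simpa [Prod.fst_sum, row_trivialX, cst, pauliX, Pi.single_apply, apply_ite] using this

variable [Fintype ι]

/-- J records the qudits j with X_j already in M. Each round turns one more constant generator into
some X_j by gates that leave J alone, and k counts the qudits still available. -/
theorem encodable_of_le_span_cst {r : ℕ} (k : ℕ) (J : Finset ι)
    (hk : Fintype.card ι - J.card = k) (M : Submodule F[T;T⁻¹] (PauliRow F ι))
    (hM : ∀ x ∈ M, ∀ y ∈ M, form x y = 0)
    (hgen : M ≤ Submodule.span F[T;T⁻¹] (cst '' {u | cst u ∈ M}))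
    (hJ : ∀ j ∈ J, cst (pauliX j) ∈ M) (hr : Module.finrank F[T;T⁻¹] M = r) :
    Encodable r ((8 * Fintype.card ι + 3) * k) M := by
  induction k generalizing J M with
  | zero | succ k ih =>
    by_cases h : ∀ u, cst u ∈ M → u.2 = 0 ∧ ∀ i, i ∉ J → u.1 i = 0
    · let a : Fin J.card ↪ ι := J.equivFin.symm.toEmbedding.trans (Function.Embedding.subtype _)
      have ha : ∀ j ∈ J, ∃ i, a i = j := fun j hj => ⟨J.equivFin ⟨j, hj⟩, by simp [a]⟩
      have heq : (Stabilizer.trivialX (F := F) a).rowSpace = M := by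
        refine le_antisymm (Submodule.span_le.2 ?_) (hgen.trans (Submodule.span_le.2 ?_))
        · rintro _ ⟨i, rfl⟩
          rw [row_trivialX]
          exact hJ _ (by simp [a])
        · rintro _ ⟨u, hu, rfl⟩
          obtain ⟨h1, h2⟩ := h u hu
          have : cst u = ∑ i, LaurentPolynomial.C (u.1 (a i)) •
              (Stabilizer.trivialX (F := F) a).row i := by
            ext1
            · ext1 j
              by_cases hj : j ∈ J
              · obtain ⟨i, rfl⟩ := ha j hj
                simp [Prod.fst_sum, row_trivialX, cst, pauliX, Pi.single_apply, apply_ite]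
              · have hne : ∀ i, j ≠ a i := fun i e => hj (by rw [e]; simp [a])
                simp [Prod.fst_sum, row_trivialX, cst, pauliX, h2 j hj, hne]
            · ext1 j
              simp [Prod.snd_sum, row_trivialX, cst, pauliX, h1]
          rw [this]
          exact Submodule.sum_mem _ fun i _ => Submodule.smul_mem _ _
            (Submodule.subset_span ⟨i, rfl⟩)
      have hcard : J.card = r := by
        rw [← hr, ← heq, Stabilizer.rowSpace, finrank_span_eq_card (linearIndependent_row_trivialX a),
          Fintype.card_fin]
      subst hcard
      exact ⟨a, [], by simp [Circuit.depth], heq ▸ Submodule.map_id _⟩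
    · push Not at h
      obtain ⟨u, hu, hu'⟩ := h
      -- Isotropy against X_j; thus subtracting multiples of the X_j removes u from J altogether.
      have hz : ∀ j ∈ J, u.2 j = 0 := by
        intro j hj
        have := congrArg (fun f => f.coeff 0) (hM _ (hJ j hj) _ hu)
        simpa [form_cst_cst, sympl_pauliX_left] using this
      let u' : Pauli F ι := u - ∑ j ∈ J, u.1 j • pauliX j
      have hu1 : ∀ i, u'.1 i = if i ∈ J then 0 else u.1 i := by
        intro i
        simp only [u', pauliX, Prod.fst_sub, Prod.fst_sum, Pi.sub_apply, Finset.sum_apply,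
          Prod.smul_mk, Pi.smul_apply, Pi.single_apply, smul_eq_mul, mul_ite, mul_one, mul_zero,
          Finset.sum_ite_eq]
        split_ifs <;> simp
      have hu2 : ∀ i, u'.2 i = u.2 i := by
        intro i
        simp [u', pauliX, Prod.snd_sum]
      have hu'M : cst u' ∈ M := by
        simp only [u', map_sub, map_sum, map_smul]
        exact M.sub_mem hu (Submodule.sum_mem _ fun j hj =>
          (M.restrictScalars F).smul_mem _ (hJ j hj))
      have hne : u' ≠ 0 := by
        intro h0
        obtain ⟨i, hi, hi'⟩ := hu' (by ext i; rw [← hu2, h0]; rfl)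
        apply hi'
        have := hu1 i
        rw [if_neg hi, h0] at this
        exact this.symm
      obtain ⟨j, φ, hjJ, h1, h2, h3⟩ := exists_clifford_to_pauliX J u'
        (fun i hi => ⟨by rw [hu1, if_pos hi], by rw [hu2, hz i hi]⟩) hne
      have hlt : J.card < Fintype.card ι := Finset.card_lt_univ_of_notMem hjJ
      -- For k = 0 there is no qudit outside J.
      first
      | (exfalso; lia)
      | have := ih (insert j J) (by rw [Finset.card_insert_of_notMem hjJ]; lia)
          (M.map φ.toLinearMap) ?_ ?_ ?_ ?_
        · have := h1.bwd _ _ _ this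
          rw [← Submodule.map_comp] at this
          simpa [Nat.mul_succ] using this
        · rintro _ ⟨x, hx, rfl⟩ _ ⟨y, hy, rfl⟩
          exact (h1.isom x y).trans (hM x hx y hy)
        · refine (Submodule.map_mono hgen).trans ?_
          rw [Submodule.map_span, Submodule.span_le]
          rintro _ ⟨_, ⟨v, hv, rfl⟩, rfl⟩
          obtain ⟨v', hv'⟩ := h1.map_cst v
          refine Submodule.subset_span ⟨v', ?_, hv'.symm⟩
          exact ⟨cst v, hv, hv'⟩
        · intro i hi
          rcases Finset.mem_insert.1 hi with rfl | hi
          · exact ⟨cst u', hu'M, h2⟩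
          · refine ⟨cst (pauliX i), hJ i hi, h3 _ fun m hm => ?_⟩
            have : m ≠ i := fun e => hm (e ▸ hi)
            simp [cst, pauliX, this]
        · rw [← hr]
          exact LinearEquiv.finrank_map_eq φ M

theorem encodable_of_degreeLE [Finite F] {r : ℕ} (N : ℕ) (M : Submodule F[T;T⁻¹] (PauliRow F ι))
    (hM : ∀ x ∈ M, ∀ y ∈ M, form x y = 0)
    (hsat : ∀ (f : F[T;T⁻¹]) (x : PauliRow F ι), f ≠ 0 → f • x ∈ M → x ∈ M)
    (hr : Module.finrank F[T;T⁻¹] M = r) (hN : DegreeLE N M) :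
    Encodable r ((8 * Fintype.card ι + 3) * Fintype.card ι + 60 * Fintype.card ι * N) M := by
  induction N using Nat.strong_induction_on generalizing M with
  | _ N ih =>
    rcases lowersDegree_or_le_span_cst hM hsat with ⟨φ, h1, h2, h3, h4⟩ | h
    · obtain ⟨hpos, hN'⟩ := hN.map φ h2 h3 h4
      have := ih (N - 1) (by lia) (M.map φ.toLinearMap) ?_ ?_ ?_ hN'
      -- The isometry simplifies M; its inverse leads back and is what the encoder executes.
      · have := h1.bwd _ _ _ this
        rw [← Submodule.map_comp] at this
        obtain ⟨n, rfl⟩ : ∃ n, N = n + 1 := ⟨N - 1, by lia⟩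
        simpa [Nat.mul_succ, add_assoc] using this
      · rintro _ ⟨x, hx, rfl⟩ _ ⟨y, hy, rfl⟩
        exact (h1.isom x y).trans (hM x hx y hy)
      · rintro f x hf ⟨y, hy, hyx⟩
        refine ⟨φ.symm x, hsat f _ hf ?_, by simp⟩
        have : f • φ.symm x = y := by
          rw [← map_smul, LinearEquiv.symm_apply_eq]; exact hyx.symm
        rwa [this]
      · rw [← hr]
        exact LinearEquiv.finrank_map_eq φ M
    · exact (encodable_of_le_span_cst _ ∅ rfl M hM h (by simp) hr).mono (by simp)

end Encoding

/-! ### Consequences of non-catastrophicity. -/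

section NonCatastrophic

variable {F : Type*} [Field F]

theorem exists_poly_iff (s : PowerSeries F) :
    (∃ f : F[X], s = (f : PowerSeries F)) ↔ ∃ N, ∀ n, N ≤ n → PowerSeries.coeff n s = 0 := by
  constructor
  · rintro ⟨f, rfl⟩
    exact ⟨f.natDegree + 1, fun n hn => by
      rw [Polynomial.coeff_coe]; exact coeff_eq_zero_of_natDegree_lt (by lia)⟩
  · rintro ⟨N, hN⟩
    refine ⟨PowerSeries.trunc N s, ?_⟩
    ext n
    rw [Polynomial.coeff_coe, PowerSeries.coeff_trunc]
    split_ifs with h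
    · rfl
    · exact hN n (by lia)

theorem NonCatastrophic.linearIndependent {ρ κ : Type*} [Fintype ρ] {G : Matrix ρ κ F[X]}
    (hG : NonCatastrophic G) : LinearIndependent F[X] G.row := by
  rw [Fintype.linearIndependent_iff]
  intro p hp i
  -- Given a relation p, the stream p / q has zero output, so p_i / q must be a polynomial. The
  -- degree of q exceeds that of p_i, which forces p_i = 0.
  let q : F[X] := 1 + X ^ ((p i).natDegree + 1)
  have hq0 : PowerSeries.constantCoeff (q : PowerSeries F) ≠ 0 := by
    simp [q]
  obtain ⟨h, hh⟩ := hG (fun k => (p k : PowerSeries F) * (q : PowerSeries F)⁻¹) (fun j => by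
    refine ⟨0, ?_⟩
    have : ∑ k, p k * G k j = 0 := by simpa using congrFun hp j
    have := congrArg (fun f : F[X] => (f : PowerSeries F) * (q : PowerSeries F)⁻¹) this
    simp only [← Polynomial.coeToPowerSeries.ringHom_apply, map_sum, map_mul, map_zero,
      zero_mul, Finset.sum_mul] at this ⊢
    rw [← this]
    exact Finset.sum_congr rfl fun k _ => by ring) i
  have h2 : (p i : PowerSeries F) = ((h * q : F[X]) : PowerSeries F) := by
    rw [Polynomial.coe_mul, ← hh, mul_assoc, PowerSeries.inv_mul_cancel _ hq0, mul_one]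
  have h3 : p i = h * q := Polynomial.coe_injective F h2
  by_contra hne
  have hh0 : h ≠ 0 := by rintro rfl; simp at h3; exact hne h3
  have hqd : q.natDegree = (p i).natDegree + 1 := by
    simp only [q]
    rw [add_comm, ← Polynomial.C_1, natDegree_X_pow_add_C]
  have hq : q ≠ 0 := by rintro h; rw [h] at hqd; simp at hqd
  have := congrArg natDegree h3
  rw [natDegree_mul hh0 hq, hqd] at this
  lia

/-- The matrix has entries over K, so it acts separately on the coordinates of a stream in a K-basis
of F. -/
theorem NonCatastrophic.map {K ρ κ : Type*} [Field K] [Algebra K F] [Module.Finite K F] [Fintype ρ]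
    {G : Matrix ρ κ K[X]} (hG : NonCatastrophic G) :
    NonCatastrophic (G.map (Polynomial.map (algebraMap K F))) := by
  intro u hu i
  let b := Module.finBasis K F
  let lam (l) (s : PowerSeries F) : PowerSeries K := PowerSeries.mk fun n =>
    b.coord l (PowerSeries.coeff n s)
  have key : ∀ l, ∃ f : K[X], lam l (u i) = f := by
    intro l
    refine hG (fun k => lam l (u k)) (fun j => ?_) i
    have : ∑ k, lam l (u k) * (G k j : PowerSeries K) = lam l (∑ k, u k *
        ((G.map (Polynomial.map (algebraMap K F)) k j : F[X]) : PowerSeries F)) := by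
      ext n
      simp only [lam, map_sum, PowerSeries.coeff_mul, PowerSeries.coeff_mk, Polynomial.coeff_coe,
        Matrix.map_apply, Polynomial.coeff_map]
      refine Finset.sum_congr rfl fun k _ => Finset.sum_congr rfl fun a _ => ?_
      rw [mul_comm (PowerSeries.coeff a.1 (u k)), ← Algebra.smul_def, map_smul, smul_eq_mul,
        mul_comm]
    rw [this]
    obtain ⟨N, hN⟩ := (exists_poly_iff _).1 (hu j)
    exact (exists_poly_iff _).2 ⟨N, fun n hn => by
      simp only [lam, PowerSeries.coeff_mk]
      rw [hN n hn, map_zero]⟩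
  simp only [exists_poly_iff] at key ⊢
  choose N hN using key
  refine ⟨∑ l, N l, fun n hn => ?_⟩
  apply b.repr.injective
  ext l
  have hle : N l ≤ ∑ l, N l := Finset.single_le_sum (fun _ _ => Nat.zero_le _) (Finset.mem_univ l)
  simpa [lam] using hN l n (by lia)

variable {ρ ι : Type*} [Fintype ρ]

/-- A constant matrix of full row rank has a constant right inverse, which recovers the input from
the output. -/
theorem Stabilizer.IsBlock.nonCatastrophic [Finite ι] {S : Stabilizer F ρ ι} (hS : S.IsBlock)
    (hli : LinearIndependent F[X] S.toMatrix.row) : NonCatastrophic S.toMatrix := by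
  classical
  have := Fintype.ofFinite ι
  let c : ρ → (ι ⊕ ι) → F := fun i j => (S.toMatrix i j).coeff 0
  have hc : ∀ i j, S.toMatrix i j = Polynomial.C (c i j) := by
    intro i j
    refine eq_C_of_natDegree_eq_zero ?_
    rcases j with j | j
    · exact (hS i j).1
    · exact (hS i j).2
  have hinj : Function.Injective (Fintype.linearCombination F c) := by
    rw [← LinearMap.ker_eq_bot, LinearMap.ker_eq_bot']
    intro a ha
    rw [Fintype.linearIndependent_iff] at hli
    ext i
    have := hli (fun i => Polynomial.C (a i)) (by
      ext1 j
      have := congrFun ha j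
      simp only [Fintype.linearCombination_apply, Finset.sum_apply, Pi.smul_apply,
        smul_eq_mul] at this
      simp only [Finset.sum_apply, Pi.smul_apply, Matrix.row, hc, smul_eq_mul, ← map_mul,
        ← map_sum, this]
      simp) i
    simpa using this
  obtain ⟨g, hg⟩ := LinearMap.exists_leftInverse_of_injective _ (LinearMap.ker_eq_bot.2 hinj)
  have hB : ∀ i k, ∑ j, c i j * g (Pi.single j 1) k = if i = k then 1 else 0 := by
    intro i k
    have h1 : g (c i) = Pi.single i 1 := by
      have := LinearMap.congr_fun hg (Pi.single i 1)
      simpa [Fintype.linearCombination_apply_single] using this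
    have h2 : c i = ∑ j, c i j • Pi.single j (1 : F) := (pi_eq_sum_univ' (c i)).trans (by simp)
    have := congrFun h1 k
    rw [h2, map_sum] at this
    simp only [map_smul, Finset.sum_apply, Pi.smul_apply, smul_eq_mul] at this
    rw [this, Pi.single_apply]
    simp [eq_comm]
  intro u hu k
  choose f hf using hu
  refine ⟨∑ j, f j * Polynomial.C (g (Pi.single j 1) k), ?_⟩
  simp only [← Polynomial.coeToPowerSeries.ringHom_apply, map_sum, map_mul] at hf ⊢
  simp only [← hf, Finset.sum_mul]
  rw [Finset.sum_comm]
  simp only [hc, mul_assoc, ← Finset.mul_sum, ← map_mul, ← map_sum, hB]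
  simp

end NonCatastrophic

/-! ### The row module of a stabilizer matrix: isotropy, saturation, degree. -/

section RowSpace

variable {F ρ ι : Type*} [Field F] [Fintype ρ]

theorem exists_toLaurent_eq_mul_T (g : ρ → F[T;T⁻¹]) :
    ∃ (n : ℕ) (p : ρ → F[X]), ∀ i, toLaurent (p i) = g i * T n := by
  choose m q hq using fun i => exists_T_pow (g i)
  refine ⟨∑ i, m i, fun i => q i * X ^ (∑ i, m i - m i), fun i => ?_⟩
  have hle : m i ≤ ∑ i, m i := Finset.single_le_sum (fun _ _ => Nat.zero_le _) (Finset.mem_univ i)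
  rw [map_mul, hq, toLaurent_X_pow, mul_T_assoc]
  congr 2
  lia

theorem Stabilizer.sum_smul_row_eq_iff (S : Stabilizer F ρ ι) (p : ρ → F[X])
    (ξ : ι ⊕ ι → F[X]) :
    ∑ i, toLaurent (p i) • S.row i =
        ((fun j => toLaurent (ξ (Sum.inl j))), fun j => toLaurent (ξ (Sum.inr j))) ↔
      ∀ j, ∑ i, p i * S.toMatrix i j = ξ j := by
  rw [Prod.ext_iff, funext_iff, funext_iff, Sum.forall]
  simp only [Prod.fst_sum, Prod.snd_sum, Finset.sum_apply, Prod.smul_fst, Prod.smul_snd,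
    Pi.smul_apply, smul_eq_mul, Stabilizer.row, ← map_mul, ← map_sum, toLaurent_inj,
    Stabilizer.toMatrix, Matrix.fromCols_apply_inl, Matrix.fromCols_apply_inr]

theorem Stabilizer.linearIndependent_row {S : Stabilizer F ρ ι}
    (hS : LinearIndependent F[X] S.toMatrix.row) : LinearIndependent F[T;T⁻¹] S.row := by
  rw [Fintype.linearIndependent_iff] at hS ⊢
  intro g hg i
  obtain ⟨n, p, hp⟩ := exists_toLaurent_eq_mul_T g
  have h0 : ∑ i, toLaurent (p i) • S.row i = 0 := by
    simp only [hp, mul_comm _ (T (n : ℤ)), mul_smul, ← Finset.smul_sum, hg, smul_zero]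
  have h1 := (S.sum_smul_row_eq_iff p 0).1 (by rw [h0]; ext <;> simp)
  have h2 := hS p (by ext1 j; simpa [Finset.sum_apply, Matrix.row] using h1 j) i
  have h3 := hp i
  rw [h2, map_zero] at h3
  exact ((isUnit_T (R := F) n).mul_left_eq_zero).1 h3.symm

theorem Stabilizer.mem_rowSpace {S : Stabilizer F ρ ι} {x : PauliRow F ι} :
    x ∈ S.rowSpace ↔ ∃ g : ρ → F[T;T⁻¹], ∑ i, g i • S.row i = x :=
  Submodule.mem_span_range_iff_exists_fun _

omit [Fintype ρ] in
theorem Stabilizer.form_eq_zero [Fintype ι] {S : Stabilizer F ρ ι} (hS : S.SelfOrthogonal) :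
    ∀ x ∈ S.rowSpace, ∀ y ∈ S.rowSpace, form x y = 0 := by
  have h1 : ∀ y, (∀ i, form (S.row i) y = 0) → ∀ x ∈ S.rowSpace, form x y = 0 := by
    intro y hy x hx
    have : S.rowSpace ≤ LinearMap.ker (formLeft y) := by
      refine Submodule.span_le.2 ?_
      rintro _ ⟨i, rfl⟩
      exact LinearMap.mem_ker.2 (hy i)
    exact LinearMap.mem_ker.1 (this hx)
  have h0 : ∀ i j, form (S.row i) (S.row j) = 0 := fun i j => by
    unfold form Stabilizer.row
    exact hS i j
  intro x hx y hy
  refine h1 y (fun i => ?_) x hx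
  rw [form_swap, h1 _ (fun j => h0 j i) y hy, map_zero, neg_zero]

omit [Fintype ρ] in
theorem exists_eq_X_pow_mul {f : F[X]} (hf : f ≠ 0) :
    ∃ (m : ℕ) (g : F[X]), f = X ^ m * g ∧ ¬ X ∣ g := by
  obtain ⟨g, h1, h2⟩ := exists_eq_pow_rootMultiplicity_mul_and_not_dvd f hf 0
  rw [Polynomial.C_0, sub_zero] at h1 h2
  exact ⟨_, g, h1, h2⟩

/-- After powers of D, which are units, are cleared, f₀ x = p S with f₀(0) ≠ 0. The power series p /
f₀ then has the polynomial output x, so it is itself a polynomial vector and exhibits x as a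
combination of rows. -/
theorem Stabilizer.saturated [Fintype ι] {S : Stabilizer F ρ ι}
    (hS : NonCatastrophic S.toMatrix) (f : F[T;T⁻¹]) (x : PauliRow F ι) (hf : f ≠ 0)
    (hfx : f • x ∈ S.rowSpace) : x ∈ S.rowSpace := by
  have hunit : ∀ (n : ℤ) (y : PauliRow F ι), (T n : F[T;T⁻¹]) • y ∈ S.rowSpace →
      y ∈ S.rowSpace := by
    intro n y hy
    have := S.rowSpace.smul_mem (T (-n)) hy
    rwa [smul_smul, ← T_add, neg_add_cancel, T_zero, one_smul] at this
  obtain ⟨a, f', hf'⟩ := exists_T_pow f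
  have hf'0 : f' ≠ 0 := by
    rintro rfl
    rw [map_zero] at hf'
    exact hf (((isUnit_T (R := F) a).mul_left_eq_zero).1 hf'.symm)
  obtain ⟨e, f₀, hf₀, hX⟩ := exists_eq_X_pow_mul hf'0
  have hf0x : ∀ y : PauliRow F ι, f • y ∈ S.rowSpace → toLaurent f₀ • y ∈ S.rowSpace := by
    intro y hy
    apply hunit e
    rw [smul_smul, ← toLaurent_X_pow, ← map_mul, ← hf₀, hf', mul_comm, mul_smul]
    exact S.rowSpace.smul_mem _ hy
  obtain ⟨g, hg⟩ := Stabilizer.mem_rowSpace.1 (hf0x x hfx)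
  obtain ⟨n, p, hp⟩ := exists_toLaurent_eq_mul_T g
  obtain ⟨m, hm⟩ := exists_T_smul_mem_posPart x
  have hξ : ∀ j : ι ⊕ ι, ∃ q : F[X], toLaurent q =
      T (n + m) * (Sum.elim x.1 x.2 j) := by
    intro j
    refine exists_toLaurent_eq _ fun k hk => ?_
    rw [add_comm, T_add, mul_comm (T (m : ℤ)), mul_assoc, coeff_T_mul]
    have := hm (k - n) (by lia)
    rcases j with j | j
    · exact congrFun (congrArg Prod.fst this) j
    · exact congrFun (congrArg Prod.snd this) j
  choose ξ hξ using hξ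
  have hx : (T (n + m) : F[T;T⁻¹]) • x =
      ((fun j => toLaurent (ξ (Sum.inl j))), fun j => toLaurent (ξ (Sum.inr j))) := by
    ext1 <;> ext1 j
    · simp only [hξ]; rfl
    · simp only [hξ]; rfl
  have hfξ : ∀ j, ∑ i, (p i * Polynomial.X ^ m) * S.toMatrix i j = f₀ * ξ j := by
    rw [← S.sum_smul_row_eq_iff (fun i => p i * Polynomial.X ^ m) (fun j => f₀ * ξ j)]
    simp only [map_mul, hp, toLaurent_X_pow, mul_T_assoc]
    have : ∑ i, (g i * T (n + m)) • S.row i = toLaurent f₀ • (T (n + m) : F[T;T⁻¹]) • x := by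
      rw [smul_comm, ← hg, Finset.smul_sum]
      exact Finset.sum_congr rfl fun i _ => by rw [smul_smul, mul_comm]
    rw [this, hx]
    rfl
  have hc : PowerSeries.constantCoeff (f₀ : PowerSeries F) ≠ 0 := by
    rw [X_dvd_iff] at hX
    simpa using hX
  obtain ⟨h, hh⟩ : ∃ h : ρ → F[X], ∀ i, p i * Polynomial.X ^ m = h i * f₀ := by
    have := hS (fun i => ((p i * Polynomial.X ^ m : F[X]) : PowerSeries F) * (f₀ : PowerSeries F)⁻¹)
      (fun j => ⟨ξ j, by
        have h1 := congrArg (fun f : F[X] => (f : PowerSeries F)) (hfξ j)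
        simp only [← Polynomial.coeToPowerSeries.ringHom_apply, map_sum, map_mul] at h1 ⊢
        have h2 : (f₀ : PowerSeries F) * (f₀ : PowerSeries F)⁻¹ = 1 :=
          PowerSeries.mul_inv_cancel _ hc
        rw [← Polynomial.coeToPowerSeries.ringHom_apply] at h2
        have h3 := congrArg (fun s => s * (Polynomial.coeToPowerSeries.ringHom f₀)⁻¹) h1
        simp only [Finset.sum_mul] at h3
        rw [mul_comm (Polynomial.coeToPowerSeries.ringHom f₀), mul_assoc, h2, mul_one] at h3
        rw [← h3]
        exact Finset.sum_congr rfl fun i _ => by ring⟩)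
    choose h hh using this
    refine ⟨h, fun i => Polynomial.coe_injective F ?_⟩
    rw [Polynomial.coe_mul (h i), ← hh, mul_assoc, PowerSeries.inv_mul_cancel _ hc, mul_one]
  have hf₀0 : f₀ ≠ 0 := by rintro rfl; simp at hX
  have hfin : ∀ j, ∑ i, h i * S.toMatrix i j = ξ j := by
    intro j
    apply mul_left_cancel₀ hf₀0
    rw [← hfξ, Finset.mul_sum]
    exact Finset.sum_congr rfl fun i _ => by rw [hh]; ring
  apply hunit (n + m)
  rw [hx, ← (S.sum_smul_row_eq_iff h ξ).2 hfin]
  exact Submodule.sum_mem _ fun i _ => Submodule.smul_mem _ _ (Submodule.subset_span ⟨i, rfl⟩)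

/-- A row of degree d has only d shifts that are possibly neither positive nor negative, those by
-1, ..., -d. They span the quotient. -/
theorem Stabilizer.degreeLE [Fintype ι] (S : Stabilizer F ρ ι) :
    DegreeLE S.constraintLength S.rowSpace := by
  classical
  let d : ρ → ℕ := fun i => Finset.univ.sup fun j => max (S.X i j).natDegree (S.Z i j).natDegree
  have hd : ∀ i j, (S.X i j).natDegree ≤ d i ∧ (S.Z i j).natDegree ≤ d i := fun i j =>
    max_le_iff.1 (Finset.le_sup (f := fun j => max (S.X i j).natDegree (S.Z i j).natDegree)
      (Finset.mem_univ j))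
  have hneg : ∀ i (k : ℤ), k < 0 → coef k (S.row i) = 0 := fun i k hk => by
    ext j
    · exact coeff_toLaurent_of_neg _ hk
    · exact coeff_toLaurent_of_neg _ hk
  have hbig : ∀ i (k : ℤ), d i < k → coef k (S.row i) = 0 := fun i k hk => by
    lift k to ℕ using by lia
    ext j
    · exact (coeff_toLaurent_natCast _ _).trans
        (coeff_eq_zero_of_natDegree_lt (by have := (hd i j).1; lia))
    · exact (coeff_toLaurent_natCast _ _).trans
        (coeff_eq_zero_of_natDegree_lt (by have := (hd i j).2; lia))
  have hrow : ∀ i, S.row i ∈ S.rowSpace := fun i => Submodule.subset_span ⟨i, rfl⟩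
  let v : (Σ i, Fin (d i)) → S.rowSpace ⧸ splitPart S.rowSpace := fun s =>
    Submodule.Quotient.mk ⟨(T (-(s.2 + 1 : ℤ)) : F[T;T⁻¹]) • S.row s.1,
      S.rowSpace.smul_mem _ (hrow s.1)⟩
  have hmono : ∀ i (n : ℤ), (Submodule.Quotient.mk ⟨(T n : F[T;T⁻¹]) • S.row i,
      S.rowSpace.smul_mem _ (hrow i)⟩ : S.rowSpace ⧸ splitPart S.rowSpace) ∈
        Submodule.span F (Set.range v) := by
    intro i n
    rcases le_or_gt 0 n with h0 | h0
    · rw [(Submodule.Quotient.mk_eq_zero _).2]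
      · exact zero_mem _
      · refine Submodule.mem_sup_left fun k hk => ?_
        change coef k ((T n : F[T;T⁻¹]) • S.row i) = 0
        rw [coef_T_smul]
        exact hneg i _ (by lia)
    · rcases lt_or_ge n (-d i) with h1 | h1
      · rw [(Submodule.Quotient.mk_eq_zero _).2]
        · exact zero_mem _
        · refine Submodule.mem_sup_right fun k hk => ?_
          change coef k ((T n : F[T;T⁻¹]) • S.row i) = 0
          rw [coef_T_smul]
          exact hbig i _ (by lia)
      · refine Submodule.subset_span ⟨⟨i, ⟨(-n - 1).toNat, by lia⟩⟩, ?_⟩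
        simp only [v]
        congr 4
        lia
  have hspan : ⊤ ≤ Submodule.span F (Set.range v) := by
    rintro x -
    obtain ⟨⟨x, hx⟩, rfl⟩ := Submodule.Quotient.mk_surjective _ x
    obtain ⟨g, rfl⟩ := Stabilizer.mem_rowSpace.1 hx
    have hsm : ∀ i (f : F[T;T⁻¹]), (Submodule.Quotient.mk ⟨f • S.row i,
      S.rowSpace.smul_mem _ (hrow i)⟩ : S.rowSpace ⧸ splitPart S.rowSpace) ∈
        Submodule.span F (Set.range v) := by
      intro i f
      induction f using LaurentPolynomial.induction_on' with
      | add p q hp hq =>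
        have := add_mem hp hq
        rw [← Submodule.Quotient.mk_add] at this
        convert this using 2
        exact Subtype.ext (add_smul _ _ _)
      | C_mul_T n a =>
        have := (Submodule.span F (Set.range v)).smul_mem a (hmono i n)
        rw [← Submodule.Quotient.mk_smul] at this
        convert this using 2
        refine Subtype.ext ?_
        change (LaurentPolynomial.C a * T n) • S.row i = a • (T n : F[T;T⁻¹]) • S.row i
        rw [← LaurentPolynomial.smul_eq_C_mul, smul_assoc]
    have := Submodule.sum_mem (Submodule.span F (Set.range v)) (t := Finset.univ)
      fun i _ => hsm i (g i)
    have e : ∑ i, (Submodule.Quotient.mk ⟨g i • S.row i, S.rowSpace.smul_mem _ (hrow i)⟩ :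
        S.rowSpace ⧸ splitPart S.rowSpace) = Submodule.Quotient.mk ⟨∑ i, g i • S.row i, hx⟩ := by
      rw [← Submodule.mkQ_apply]
      simp only [← Submodule.mkQ_apply, ← map_sum]
      congr 1
      exact Subtype.ext (by simp)
    rwa [e] at this
  have hfin : Module.Finite F (S.rowSpace ⧸ splitPart S.rowSpace) :=
    ⟨⟨Finset.univ.image v, by rw [Finset.coe_image, Finset.coe_univ, Set.image_univ]; exact top_le_iff.1 hspan⟩⟩
  refine ⟨hfin, ?_⟩
  have := finrank_range_le_card (R := F) v
  rw [Set.finrank, top_le_iff.1 hspan, finrank_top] at this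
  refine this.trans (le_of_eq ?_)
  rw [Fintype.card_sigma]
  simp only [Fintype.card_fin]
  rfl

theorem Stabilizer.encodable [Finite F] [Fintype ι] [DecidableEq ι] {r : ℕ}
    (S : Stabilizer F (Fin r) ι) (hS : NonCatastrophic S.toMatrix) (hS' : S.SelfOrthogonal) :
    Encodable r (71 * Fintype.card ι ^ 2 * (S.constraintLength + 1)) S.rowSpace := by
  refine (encodable_of_degreeLE S.constraintLength S.rowSpace (Stabilizer.form_eq_zero hS')
    (Stabilizer.saturated hS) ?_ S.degreeLE).mono ?_
  · rw [Stabilizer.rowSpace, finrank_span_eq_card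
      (Stabilizer.linearIndependent_row hS.linearIndependent), Fintype.card_fin]
  · generalize Fintype.card ι = n
    generalize S.constraintLength = N
    have h : n ≤ n ^ 2 := Nat.le_self_pow (by norm_num) n
    have h' : n * N ≤ n ^ 2 * N := Nat.mul_le_mul_right N h
    nlinarith

end RowSpace

/-! ### Copies of a circuit on disjoint sets of qudits. -/

section Copies

variable {F ι κ : Type*} [Field F] [DecidableEq ι] [DecidableEq κ]

/-- The components of a row on the qudits in the range of `f`. -/
def PauliRow.restrict (f : ι ↪ κ) (v : PauliRow F κ) : PauliRow F ι := (v.1 ∘ f, v.2 ∘ f)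

theorem Gate.restrict_act_map (f : ι ↪ κ) (g : Gate F ι) (v : PauliRow F κ) :
    PauliRow.restrict f ((g.map f).act v) = g.act (PauliRow.restrict f v) := by
  cases g <;> simp [PauliRow.restrict, Gate.map, Gate.act,
    Function.update_comp_eq_of_injective _ f.injective, -T_mul]

omit [DecidableEq ι] in
theorem Gate.act_map_of_notMem (f : ι ↪ κ) (g : Gate F ι) (v : PauliRow F κ) {k : κ}
    (hk : k ∉ Set.range f) :
    ((g.map f).act v).1 k = v.1 k ∧ ((g.map f).act v).2 k = v.2 k := by
  have : ∀ i, k ≠ f i := fun i e => hk ⟨i, e.symm⟩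
  cases g <;> simp [Gate.map, Gate.act, this]

theorem Layer.restrict_act_map (f : ι ↪ κ) (L : Layer F ι) (v : PauliRow F κ) :
    PauliRow.restrict f ((L.map f).act v) = L.act (PauliRow.restrict f v) := by
  simp only [Layer.act, Layer.map]
  induction L.gates generalizing v with
  | nil => rfl
  | cons g l ih => simp only [List.map_cons, List.foldl_cons, ih, Gate.restrict_act_map]

omit [DecidableEq ι] in
theorem Layer.act_map_of_notMem (f : ι ↪ κ) (L : Layer F ι) (v : PauliRow F κ) {k : κ}
    (hk : k ∉ Set.range f) :
    ((L.map f).act v).1 k = v.1 k ∧ ((L.map f).act v).2 k = v.2 k := by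
  simp only [Layer.act, Layer.map]
  induction L.gates generalizing v with
  | nil => exact ⟨rfl, rfl⟩
  | cons g l ih =>
    have h := Gate.act_map_of_notMem f g v hk
    have h' := ih ((g.map f).act v)
    simp only [List.map_cons, List.foldl_cons]
    exact ⟨h'.1.trans h.1, h'.2.trans h.2⟩

theorem Circuit.restrict_act_map (f : ι ↪ κ) (c : Circuit F ι) (v : PauliRow F κ) :
    PauliRow.restrict f ((c.map f).act v) = c.act (PauliRow.restrict f v) := by
  induction c generalizing v with
  | nil => rfl
  | cons L c ih =>
    change PauliRow.restrict f (Circuit.act (Circuit.map f c) ((L.map f).act v)) = _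
    rw [ih, Layer.restrict_act_map]; rfl

omit [DecidableEq ι] in
theorem Circuit.act_map_of_notMem (f : ι ↪ κ) (c : Circuit F ι) (v : PauliRow F κ) {k : κ}
    (hk : k ∉ Set.range f) :
    ((c.map f).act v).1 k = v.1 k ∧ ((c.map f).act v).2 k = v.2 k := by
  induction c generalizing v with
  | nil => exact ⟨rfl, rfl⟩
  | cons L c ih =>
    have h := Layer.act_map_of_notMem f L v hk
    have h' := ih ((L.map f).act v)
    exact ⟨h'.1.trans h.1, h'.2.trans h.2⟩

/-- The copies have disjoint supports: each one sees the original input, and later ones do not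
disturb its output. -/
theorem Circuit.act_flatMap {α : Type*} (f : α → ι ↪ κ)
    (hf : ∀ j j', j ≠ j' → ∀ i i', f j i ≠ f j' i') (c : Circuit F ι) (l : List α) (hl : l.Nodup)
    (v : PauliRow F κ) :
    (∀ j ∈ l, PauliRow.restrict (f j) (Circuit.act (l.flatMap fun j => c.map (f j)) v) =
      c.act (PauliRow.restrict (f j) v)) ∧
    ∀ k, (∀ j ∈ l, k ∉ Set.range (f j)) →
      (Circuit.act (l.flatMap fun j => c.map (f j)) v).1 k = v.1 k ∧
      (Circuit.act (l.flatMap fun j => c.map (f j)) v).2 k = v.2 k := by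
  induction l generalizing v with
  | nil => exact ⟨by simp, fun k _ => ⟨rfl, rfl⟩⟩
  | cons a l ih =>
    rw [List.nodup_cons] at hl
    obtain ⟨ih1, ih2⟩ := ih hl.2 ((c.map (f a)).act v)
    simp only [List.flatMap_cons, Circuit.act_append]
    refine ⟨fun j hj => ?_, fun k hk => ?_⟩
    · rcases List.mem_cons.1 hj with rfl | hj
      · rw [← Circuit.restrict_act_map]
        have : ∀ i, ∀ j' ∈ l, f j i ∉ Set.range (f j') := by
          rintro i j' hj' ⟨i', hi'⟩
          exact hf j' j (fun e => hl.1 (e ▸ hj')) i' i hi'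
        ext1 <;> ext1 i
        · exact (ih2 (f j i) (this i)).1
        · exact (ih2 (f j i) (this i)).2
      · rw [ih1 j hj]
        congr 1
        have hne : j ≠ a := fun e => hl.1 (e ▸ hj)
        have : ∀ i, f j i ∉ Set.range (f a) := by
          rintro i ⟨i', hi'⟩
          exact hf a j hne.symm i' i hi'
        ext1 <;> ext1 i
        · exact (Circuit.act_map_of_notMem (f a) c v (this i)).1
        · exact (Circuit.act_map_of_notMem (f a) c v (this i)).2
    · have h1 := ih2 k fun j hj => hk j (List.mem_cons_of_mem _ hj)
      have h2 := Circuit.act_map_of_notMem (f a) c v (hk a List.mem_cons_self)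
      exact ⟨h1.1.trans h2.1, h1.2.trans h2.2⟩

omit [DecidableEq ι] [DecidableEq κ] in
theorem Gate.duration_map (f : ι ↪ κ) (g : Gate F ι) : (g.map f).duration = g.duration := by
  cases g <;> rfl

-- The copies are counted as if run one after the other; the extra factor is harmless for a
-- polynomial bound.
omit [DecidableEq ι] [DecidableEq κ] in
theorem Circuit.depth_flatMap {α : Type*} (f : α → ι ↪ κ) (c : Circuit F ι) (l : List α) :
    Circuit.depth (l.flatMap fun j => c.map (f j)) = l.length * c.depth := by
  have h : ∀ j, Circuit.depth (c.map (f j)) = c.depth := by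
    intro j
    simp [Circuit.depth, Circuit.map, Layer.duration, Layer.map, Function.comp_def,
      Gate.duration_map]
    rfl
  induction l with
  | nil => simp [Circuit.depth]
  | cons a l ih => rw [List.flatMap_cons, Circuit.depth_append, h, ih, List.length_cons]; ring

end Copies

/-! ### From Z-only to X-only ancillae. -/

section Fourier

variable {F ι : Type*} [Field F]

/-- The Fourier transform on all qudits of the frame. -/
noncomputable def dftLayer (F ι : Type*) [Field F] [Fintype ι] : Layer F ι where
  gates := Finset.univ.toList.map Gate.dft
  disjoint := by
    refine List.Pairwise.map _ (fun i j (hij : i ≠ j) => ?_) (Finset.nodup_toList Finset.univ)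
    simpa [Gate.wires] using hij

theorem duration_dftLayer_le [Fintype ι] : (dftLayer F ι).duration ≤ 1 := by
  simp only [Layer.duration, dftLayer]
  induction (Finset.univ : Finset ι).toList with
  | nil => simp
  | cons i l ih => simpa [Gate.duration] using ih

theorem foldl_act_dft [DecidableEq ι] (l : List ι) (hl : l.Nodup) (v : PauliRow F ι) :
    (l.map Gate.dft).foldl (fun w g => g.act w) v =
      (fun i => if i ∈ l then v.2 i else v.1 i, fun i => if i ∈ l then -v.1 i else v.2 i) := by
  induction l generalizing v with
  | nil => simp
  | cons a l ih =>
    rw [List.nodup_cons] at hl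
    rw [List.map_cons, List.foldl_cons, ih hl.2]
    ext1 <;> ext1 i <;> by_cases h : i = a <;> by_cases h' : i ∈ l <;>
      simp_all [Gate.act]

theorem act_dftLayer [Fintype ι] [DecidableEq ι] (v : PauliRow F ι) :
    (dftLayer F ι).act v = (v.2, -v.1) := by
  simp only [Layer.act, dftLayer, foldl_act_dft _ (Finset.nodup_toList Finset.univ),
    Finset.mem_toList, Finset.mem_univ, if_true]
  rfl

/-- Transforming every qudit rather than the ancillae only does no harm, as the generators vanish
elsewhere. -/
theorem act_dftLayer_trivialZ [Fintype ι] [DecidableEq ι] {ρ : Type*} (a : ρ ↪ ι) (i : ρ) :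
    (dftLayer F ι).act ((Stabilizer.trivialZ (F := F) a).row i) =
      (Stabilizer.trivialX (F := F) a).row i := by
  rw [act_dftLayer]
  ext1 <;> ext1 j <;> simp [Stabilizer.row, Stabilizer.trivialX, Stabilizer.trivialZ]

end Fourier

/-! ### The product construction. -/

section Product

variable {F ι κ : Type*} [Field F]

/-- The row `(g ⊗ x | g ⊗ z)`. -/
noncomputable def tensorRow :
    (ι → F[T;T⁻¹]) →ₗ[F[T;T⁻¹]] PauliRow F κ →ₗ[F[T;T⁻¹]] PauliRow F (ι × κ) :=
  LinearMap.mk₂ _ (fun g h => (fun q => g q.1 * h.1 q.2, fun q => g q.1 * h.2 q.2))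
    (fun g g' h => by ext1 <;> ext1 q <;> simp [add_mul])
    (fun f g h => by ext1 <;> ext1 q <;> simp [mul_assoc])
    (fun g h h' => by ext1 <;> ext1 q <;> simp [mul_add])
    (fun f g h => by ext1 <;> ext1 q <;> simp [mul_left_comm])

theorem tensorRow_apply (g : ι → F[T;T⁻¹]) (h : PauliRow F κ) :
    tensorRow g h = (fun q => g q.1 * h.1 q.2, fun q => g q.1 * h.2 q.2) := rfl

theorem rowSpace_product {K ρ σ : Type*} [Field K] [Algebra K F] (G : Matrix ρ ι K[X])
    (S : Stabilizer F σ κ) :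
    (Stabilizer.product G S).rowSpace =
      Submodule.map₂ tensorRow
        ((Stabilizer.ofX (F := F) G).rowSpace.map (LinearMap.fst _ _ _)) S.rowSpace := by
  rw [Stabilizer.rowSpace, Stabilizer.rowSpace, Stabilizer.rowSpace, Submodule.map_span,
    ← Set.range_comp, Submodule.map₂_span_span, Set.image2_range]
  congr 2
  ext1 ⟨i, j⟩
  ext1 <;> ext1 q <;>
    simp [Stabilizer.row, Stabilizer.product, Stabilizer.ofX, tensorRow_apply]

/-- Only strand j is excited by the ancilla (i, j), and it leaves the first stage with X-components
g alone. Block b then contains g_b X_j, so Laurent-linearity of the second circuit finishes; a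
Z-part of g would give block b an input outside the span of X_j. -/
theorem Circuit.act_product {n r k : ℕ} [DecidableEq κ] (a₁ : Fin k ↪ Fin n) (a₂ : Fin r ↪ κ)
    (c : Circuit F (Fin n)) (d : Circuit F κ) (i : Fin k) (j : Fin r)
    (hc : (c.act ((Stabilizer.trivialZ (F := F) a₁).row i)).2 = 0) :
    Circuit.act (c.strandCopies a₂ ++ d.blockCopies n)
        ((Stabilizer.trivialZ (F := F) (a₁.prodMap a₂)).row (i, j)) =
      tensorRow (c.act ((Stabilizer.trivialZ (F := F) a₁).row i)).1
        (d.act ((Stabilizer.trivialX (F := F) a₂).row j)) := by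
  set v₀ := (Stabilizer.trivialZ (F := F) (a₁.prodMap a₂)).row (i, j) with hv₀
  set g := c.act ((Stabilizer.trivialZ (F := F) a₁).row i) with hg
  have hv₀1 : ∀ q, v₀.1 q = 0 := fun q => by simp [hv₀, Stabilizer.row, Stabilizer.trivialZ]
  have hv₀2 : ∀ q, v₀.2 q = if q = (a₁ i, a₂ j) then 1 else 0 := fun q => by
    by_cases h : q = (a₁ i, a₂ j) <;> simp [hv₀, Stabilizer.row, Stabilizer.trivialZ, h]
  rw [Circuit.act_append]
  obtain ⟨hs1, hs2⟩ := Circuit.act_flatMap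
    (fun j : Fin r => (⟨fun i => (i, a₂ j), fun _ _ h => (Prod.ext_iff.1 h).1⟩ :
      Fin n ↪ Fin n × κ))
    (fun j j' hj i i' h => hj (a₂.injective (Prod.ext_iff.1 h).2)) c (List.finRange r)
    (List.nodup_finRange r) v₀
  change (∀ j ∈ _, PauliRow.restrict _ (Circuit.act (c.strandCopies a₂) v₀) = _) at hs1
  change (∀ k, _ → (Circuit.act (c.strandCopies a₂) v₀).1 k = _ ∧
    (Circuit.act (c.strandCopies a₂) v₀).2 k = _) at hs2
  generalize hv₁ : Circuit.act (c.strandCopies a₂) v₀ = v₁ at hs1 hs2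
  have hv₁' : v₁ = tensorRow g.1 ((Stabilizer.trivialX (F := F) a₂).row j) := by
    have key : ∀ b k, v₁.1 (b, k) = (if k = a₂ j then g.1 b else 0) ∧ v₁.2 (b, k) = 0 := by
      intro b k
      by_cases hk : ∃ j', a₂ j' = k
      · obtain ⟨j', rfl⟩ := hk
        have h := hs1 j' (List.mem_finRange j')
        by_cases hj : j' = j
        · subst hj
          have e : PauliRow.restrict (⟨fun i => (i, a₂ j'), fun _ _ h => (Prod.ext_iff.1 h).1⟩ :
              Fin n ↪ Fin n × κ) v₀ = (Stabilizer.trivialZ (F := F) a₁).row i := by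
            ext1 <;> ext1 m
            · simpa [PauliRow.restrict, Stabilizer.row, Stabilizer.trivialZ] using hv₀1 _
            · refine (hv₀2 (m, a₂ j')).trans ?_
              by_cases hm : m = a₁ i <;> simp [Stabilizer.row, Stabilizer.trivialZ, hm]
          rw [e, ← hg] at h
          rw [if_pos rfl]
          refine ⟨congrFun (congrArg Prod.fst h) b, ?_⟩
          exact (congrFun (congrArg Prod.snd h) b).trans (congrFun hc b)
        · have e : PauliRow.restrict (⟨fun i => (i, a₂ j'), fun _ _ h => (Prod.ext_iff.1 h).1⟩ :
              Fin n ↪ Fin n × κ) v₀ = 0 := by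
            ext1 <;> ext1 m
            · simpa [PauliRow.restrict] using hv₀1 _
            · refine (hv₀2 (m, a₂ j')).trans (if_neg fun h => hj ?_)
              exact a₂.injective (Prod.ext_iff.1 h).2
          rw [e, ← Circuit.lin_apply, map_zero] at h
          rw [if_neg (fun h => hj (a₂.injective h))]
          exact ⟨congrFun (congrArg Prod.fst h) b, congrFun (congrArg Prod.snd h) b⟩
      · have hk' : ∀ j', a₂ j' ≠ k := fun j' h => hk ⟨j', h⟩
        have h := hs2 (b, k) (by
          rintro j' - ⟨i', hi'⟩
          exact hk' j' (Prod.ext_iff.1 hi').2)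
        rw [h.1, h.2, hv₀1, hv₀2, if_neg (fun h => hk' j h.symm),
          if_neg (fun h => hk' j (Prod.ext_iff.1 h).2.symm)]
        exact ⟨rfl, rfl⟩
    ext1 <;> ext1 q
    · rw [(key q.1 q.2).1]
      by_cases h : q.2 = a₂ j <;> simp [tensorRow_apply, Stabilizer.row, Stabilizer.trivialX, h]
    · rw [(key q.1 q.2).2]
      simp [tensorRow_apply, Stabilizer.row, Stabilizer.trivialX]
  obtain ⟨ht1, -⟩ := Circuit.act_flatMap
    (fun b : Fin n => (⟨fun i => (b, i), fun _ _ h => (Prod.ext_iff.1 h).2⟩ : κ ↪ Fin n × κ))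
    (fun j j' hj i i' h => hj (Prod.ext_iff.1 h).1) d (List.finRange n) (List.nodup_finRange n) v₁
  change (∀ j ∈ _, PauliRow.restrict _ (Circuit.act (d.blockCopies n) v₁) = _) at ht1
  have hfin : ∀ b, PauliRow.restrict (⟨fun i => (b, i), fun _ _ h => (Prod.ext_iff.1 h).2⟩ :
      κ ↪ Fin n × κ) (Circuit.act (d.blockCopies n) v₁) =
        g.1 b • d.act ((Stabilizer.trivialX (F := F) a₂).row j) := by
    intro b
    rw [ht1 b (List.mem_finRange b), ← Circuit.lin_apply, ← Circuit.lin_apply, ← map_smul]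
    congr 1
    rw [hv₁']
    rfl
  ext1 <;> ext1 q
  · exact congrFun (congrArg Prod.fst (hfin q.1)) q.2
  · exact congrFun (congrArg Prod.snd (hfin q.1)) q.2

theorem Circuit.transforms_product {K : Type*} [Field K] [Algebra K F] {n r k : ℕ} [DecidableEq κ]
    {a₁ : Fin k ↪ Fin n} {a₂ : Fin r ↪ κ} {c : Circuit F (Fin n)} {d : Circuit F κ}
    {G : Matrix (Fin k) (Fin n) K[X]} {S : Stabilizer F (Fin r) κ}
    (hc : c.Transforms (Stabilizer.trivialZ a₁) (Stabilizer.ofX G))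
    (hd : d.Transforms (Stabilizer.trivialX a₂) S) :
    Circuit.Transforms (c.strandCopies a₂ ++ d.blockCopies n)
      (Stabilizer.trivialZ (a₁.prodMap a₂)) (Stabilizer.product G S) := by
  -- The images lie in the module of a CSS-type stabilizer, whose Z-part vanishes.
  have hz : ∀ i, (c.act ((Stabilizer.trivialZ (F := F) a₁).row i)).2 = 0 := by
    intro i
    have h1 : c.act ((Stabilizer.trivialZ (F := F) a₁).row i) ∈
        (Stabilizer.ofX (F := F) G).rowSpace := by
      rw [← hc]; exact Submodule.subset_span ⟨i, rfl⟩
    have h2 : (Stabilizer.ofX (F := F) G).rowSpace ≤ LinearMap.ker (LinearMap.snd _ _ _) := by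
      refine Submodule.span_le.2 ?_
      rintro _ ⟨i, rfl⟩
      refine LinearMap.mem_ker.2 ?_
      ext1 j
      simp [Stabilizer.row, Stabilizer.ofX]
    exact LinearMap.mem_ker.1 (h2 h1)
  rw [Circuit.Transforms, rowSpace_product, ← hc, ← hd, Submodule.map_span, ← Set.range_comp,
    Submodule.map₂_span_span, Set.image2_range]
  congr 2
  ext1 ⟨i, j⟩
  exact Circuit.act_product a₁ a₂ c d i j (hz i)

/-! ### Constraint lengths of the factors and of the product. -/

section ConstraintLength

variable [Fintype ι] [Fintype κ] {K ρ σ : Type*} [Field K] [Algebra K F] [Fintype ρ] [Fintype σ]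

/-- A nonzero entry in row j suffices: degrees add in products, so multiplying by it cannot lower
the degrees of G. -/
theorem constraintLength_ofX_le (G : Matrix ρ ι K[X]) (S : Stabilizer F σ κ) (j : σ)
    (hj : S.toMatrix.row j ≠ 0) :
    (Stabilizer.ofX (F := F) G).constraintLength ≤ (Stabilizer.product G S).constraintLength := by
  have hk : ∃ k, S.X j k ≠ 0 ∨ S.Z j k ≠ 0 := by
    by_contra! h
    refine hj (funext fun k => ?_)
    rcases k with k | k
    · exact (h k).1
    · exact (h k).2
  obtain ⟨k, hk⟩ := hk
  simp only [Stabilizer.constraintLength]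
  rw [Fintype.sum_prod_type]
  refine Finset.sum_le_sum fun i _ => le_trans ?_ (Finset.single_le_sum
    (f := fun j => Finset.univ.sup fun q => max ((Stabilizer.product G S).X (i, j) q).natDegree
      ((Stabilizer.product G S).Z (i, j) q).natDegree) (fun _ _ => Nat.zero_le _)
    (Finset.mem_univ j))
  refine Finset.sup_le fun b _ => ?_
  refine le_trans ?_ (Finset.le_sup (f := fun q => max
    ((Stabilizer.product G S).X (i, j) q).natDegree
      ((Stabilizer.product G S).Z (i, j) q).natDegree) (Finset.mem_univ (b, k)))
  by_cases hG : G i b = 0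
  · simp [Stabilizer.ofX, hG]
  · have hG' : (G i b).map (algebraMap K F) ≠ 0 := by
      rwa [ne_eq, Polynomial.map_eq_zero]
    simp only [Stabilizer.ofX, Stabilizer.product, Matrix.kroneckerMap_apply, Matrix.map_apply,
      Matrix.zero_apply, natDegree_zero, max_le_iff, zero_le, and_true, le_max_iff]
    rcases hk with hk | hk
    · left; rw [natDegree_mul hG' hk]; lia
    · right; rw [natDegree_mul hG' hk]; lia

theorem constraintLength_le_product (G : Matrix ρ ι K[X]) (S : Stabilizer F σ κ) (i : ρ)
    (hi : G.row i ≠ 0) :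
    S.constraintLength ≤ (Stabilizer.product G S).constraintLength := by
  have hb : ∃ b, G i b ≠ 0 := by
    by_contra! h
    exact hi (funext h)
  obtain ⟨b, hb⟩ := hb
  simp only [Stabilizer.constraintLength]
  rw [Fintype.sum_prod_type_right]
  refine Finset.sum_le_sum fun j _ => le_trans ?_ (Finset.single_le_sum
    (f := fun i => Finset.univ.sup fun q => max ((Stabilizer.product G S).X (i, j) q).natDegree
      ((Stabilizer.product G S).Z (i, j) q).natDegree) (fun _ _ => Nat.zero_le _)
    (Finset.mem_univ i))
  refine Finset.sup_le fun k _ => ?_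
  refine le_trans ?_ (Finset.le_sup (f := fun q => max
    ((Stabilizer.product G S).X (i, j) q).natDegree
      ((Stabilizer.product G S).Z (i, j) q).natDegree) (Finset.mem_univ (b, k)))
  have hG' : (G i b).map (algebraMap K F) ≠ 0 := by
    rwa [ne_eq, Polynomial.map_eq_zero]
  have key : ∀ s : F[X], s.natDegree ≤ ((G i b).map (algebraMap K F) * s).natDegree := by
    intro s
    by_cases hs : s = 0
    · simp [hs]
    · rw [natDegree_mul hG' hs]; lia
  exact max_le_max (key _) (key _)

end ConstraintLength

theorem NonCatastrophic.ofX {K ρ : Type*} [Field K] [Algebra K F] [Module.Finite K F] [Fintype ρ]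
    {G : Matrix ρ ι K[X]} (hG : NonCatastrophic G) :
    NonCatastrophic (Stabilizer.ofX (F := F) G).toMatrix :=
  fun u hu => hG.map u fun j => hu (Sum.inl j)

theorem selfOrthogonal_ofX {K ρ : Type*} [Field K] [Algebra K F] [Fintype ι]
    (G : Matrix ρ ι K[X]) : (Stabilizer.ofX (F := F) G).SelfOrthogonal := by
  intro i j
  simp [Stabilizer.ofX]

end Product

end QConv

/-! ### The main theorem. -/

theorem mainTheorem2 :
    ∃ P : MvPolynomial (Fin 2) ℕ,
      ∀ (p : ℕ) [Fact p.Prime] (F : Type*) [Field F] [Finite F] [Algebra (ZMod p) F]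
        (k₁ n₁ r n₂ : ℕ) (G₁ : Matrix (Fin k₁) (Fin n₁) (ZMod p)[X])
        (S₂ : Stabilizer F (Fin r) (Fin n₂)),
        0 < k₁ → NonCatastrophic G₁ → DelayFree G₁ →
        S₂.IsQCC → (S₂.IsBlock ∨ NonCatastrophic S₂.toMatrix) →
        ∃ (a₁ : Fin k₁ ↪ Fin n₁) (a₂ : Fin r ↪ Fin n₂)
          (CC : Circuit F (Fin n₁)) (BC : Circuit F (Fin n₂)),
          CC.Transforms (Stabilizer.trivialZ a₁) (Stabilizer.ofX G₁) ∧
          BC.Transforms (Stabilizer.trivialX a₂) S₂ ∧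
          (CC.strandCopies a₂ ++ BC.blockCopies n₁).Transforms
            (Stabilizer.trivialZ (a₁.prodMap a₂)) (Stabilizer.product G₁ S₂) ∧
          Circuit.depth (CC.strandCopies a₂ ++ BC.blockCopies n₁) ≤
            MvPolynomial.eval ![n₁ * n₂, (Stabilizer.product G₁ S₂).constraintLength] P := by
  -- The linear term pays for the Fourier layers of the r ≤ n₁ n₂ strands, and 142 = 2 · 71 for the
  -- two families of circuits.
  refine ⟨MvPolynomial.X 0 + 142 * MvPolynomial.X 0 ^ 2 * (MvPolynomial.X 1 + 1), ?_⟩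
  intro p _ F _ _ _ k₁ n₁ r n₂ G₁ S₂ hk₁ hG₁ _ hS₂ hS₂'
  have hS : NonCatastrophic S₂.toMatrix := hS₂'.elim (fun h => h.nonCatastrophic hS₂.1) id
  obtain ⟨a₂, BC, hBCd, hBC⟩ := S₂.encodable hS hS₂.2
  obtain ⟨a₁, c, hcd, hc⟩ :=
    (Stabilizer.ofX (F := F) G₁).encodable hG₁.ofX (selfOrthogonal_ofX G₁)
  have hBC' : BC.Transforms (Stabilizer.trivialX a₂) S₂ := (Circuit.transforms_iff _ _ _).2 hBC
  have hCC : Circuit.Transforms (dftLayer F (Fin n₁) :: c) (Stabilizer.trivialZ a₁)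
      (Stabilizer.ofX G₁) := by
    rw [← Circuit.transforms_iff] at hc
    rw [Circuit.Transforms, ← hc]
    simp only [Circuit.act_cons, act_dftLayer_trivialZ]
  refine ⟨a₁, a₂, dftLayer F (Fin n₁) :: c, BC, hCC, hBC', Circuit.transforms_product hCC hBC', ?_⟩
  rw [Circuit.depth_append, Circuit.strandCopies, Circuit.blockCopies, Circuit.depth_flatMap,
    Circuit.depth_flatMap, List.length_finRange, List.length_finRange]
  set ν := (Stabilizer.product G₁ S₂).constraintLength
  have hr : r ≤ n₂ := by simpa using Fintype.card_le_of_embedding a₂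
  have hn₁ : 1 ≤ n₁ := by
    have : k₁ ≤ n₁ := by simpa using Fintype.card_le_of_embedding a₁
    lia
  have hν₂ : S₂.constraintLength ≤ ν :=
    constraintLength_le_product G₁ S₂ ⟨0, hk₁⟩ (hG₁.linearIndependent.ne_zero _)
  -- The factor r is kept because for r = 0 the product has no rows and ν does not control G₁.
  have hν₁ : r * ((Stabilizer.ofX (F := F) G₁).constraintLength + 1) ≤ r * (ν + 1) := by
    rcases Nat.eq_zero_or_pos r with rfl | hr0
    · simp
    · exact Nat.mul_le_mul_left _ (Nat.succ_le_succ
        (constraintLength_ofX_le G₁ S₂ ⟨0, hr0⟩ (hS.linearIndependent.ne_zero _)))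
  rw [Fintype.card_fin] at hBCd hcd
  have hd1 : Circuit.depth (dftLayer F (Fin n₁) :: c) ≤
      1 + 71 * n₁ ^ 2 * ((Stabilizer.ofX (F := F) G₁).constraintLength + 1) := by
    have h1 : Circuit.depth (dftLayer F (Fin n₁) :: c) =
        (dftLayer F (Fin n₁)).duration + c.depth := by simp [Circuit.depth]
    rw [h1]
    exact Nat.add_le_add duration_dftLayer_le hcd
  have hrn : r ≤ n₁ * n₂ := hr.trans (Nat.le_mul_of_pos_left _ hn₁)
  have e1 : r * Circuit.depth (dftLayer F (Fin n₁) :: c) ≤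
      n₁ * n₂ + 71 * (n₁ * n₂) ^ 2 * (ν + 1) := calc
    _ ≤ r * (1 + 71 * n₁ ^ 2 * ((Stabilizer.ofX (F := F) G₁).constraintLength + 1)) :=
        Nat.mul_le_mul_left _ hd1
    _ = r + 71 * n₁ ^ 2 * (r * ((Stabilizer.ofX (F := F) G₁).constraintLength + 1)) := by ring
    _ ≤ n₁ * n₂ + 71 * n₁ ^ 2 * (n₂ ^ 2 * (ν + 1)) := by
        have h2 : r ≤ n₂ ^ 2 := hr.trans (Nat.le_self_pow (by norm_num) n₂)
        exact Nat.add_le_add hrn (Nat.mul_le_mul_left _ (hν₁.trans (Nat.mul_le_mul_right _ h2)))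
    _ = _ := by ring
  have e2 : n₁ * BC.depth ≤ 71 * (n₁ * n₂) ^ 2 * (ν + 1) := calc
    _ ≤ n₁ ^ 2 * (71 * n₂ ^ 2 * (ν + 1)) :=
        Nat.mul_le_mul (Nat.le_self_pow (by norm_num) n₁)
          (hBCd.trans (Nat.mul_le_mul_left _ (Nat.succ_le_succ hν₂)))
    _ = _ := by ring
  simp only [map_add, map_mul, map_pow, MvPolynomial.eval_X, map_one, map_ofNat,
    Matrix.cons_val_zero, Matrix.cons_val_one]
  calc _ ≤ (n₁ * n₂ + 71 * (n₁ * n₂) ^ 2 * (ν + 1)) + 71 * (n₁ * n₂) ^ 2 * (ν + 1) :=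
        Nat.add_le_add e1 e2
    _ = _ := by ring
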